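/- Let $d\ge 1$. Consider the zero-temperature stochastic homogeneous ferromagnetic Ising model $(\sigma^t)_{t\ge 0}$ on $\mathbb Z^d$, with state space $\{-1,+1\}^{\mathbb Z^d}$: the sites carry independent rate-one Poisson clocks, and a fair coin is attached to each clock ring, all of these being independent of each other and of the initial state $\sigma^0$. When the clock at $x$ rings, the energy change $\Delta\mathcal H_x(\sigma)=2\sum_{y:\|x-y\|=1}\sigma_x\sigma_y$ is computed in the configuration $\sigma$ just before the ring; the spin at $x$ flips if $\Delta\mathcal H_x(\sigma)<0$, does not flip if $\Delta\mathcal H_x(\sigma)>0$, and flips according to the result of the coin toss (that is, with probability $1/2$) if $\Delta\mathcal H_x(\sigma)=0$; otherwise no spin changes. Let $C_o(t)$ be the cluster of the origin $o$ at time $t$, i.e. the maximal set of sites that contains $o$, is connected by nearest-neighbour steps, and on which $\sigma^t$ is constant, and let $|C_o(t)|\in\{1,2,\dots\}\cup\{\infty\}$ be its number of sites. If $\sigma^0$ is distributed according to the symmetric Bernoulli product measure on $\{-1,+1\}^{\mathbb Z^d}$, then almost surely (with respect to the initial state and the dynamics) the process is well defined, i.e. there is exactly one trajectory $(\sigma^t)_{t\ge0}$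 that follows the above rules, and $$\lim_{t\to\infty}|C_o(t)|=\infty .$$ The same holds if $\sigma^0$ is distributed according to any probability measure on $\{-1,+1\}^{\mathbb Z^d}$ that is invariant under all translations of $\mathbb Z^d$. -/

import Mathlib

open MeasureTheory ProbabilityTheory Filter Topology
open scoped NNReal ENNReal

namespace ZeroTempIsing

/-- Sites of the lattice `ℤ^d`. -/
abbrev Site (d : ℕ) : Type := Fin d → ℤ

/-- Spin configurations: assignments of `+1` or `-1` (the units of `ℤ`) to the sites. It carries
the product sigma-algebra. -/
abbrev Config (d : ℕ) : Type := Site d → ℤˣ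

/-- The nearest-neighbour graph of `ℤ^d`: `x` and `y` are adjacent when their Euclidean distance
(equivalently its square, written here in integers) equals one. -/
def lattice (d : ℕ) : SimpleGraph (Site d) where
  Adj x y := ∑ i, (x i - y i) ^ 2 = 1
  symm := ⟨fun x y h => by
    rw [← h]
    exact Finset.sum_congr rfl fun i _ => by ring⟩
  loopless := ⟨fun x h => by simp at h⟩

/-- The neighbours of `x` are the `2 d` sites `x ± e_i`. -/
theorem lattice_adj_iff {d : ℕ} (x y : Site d) :
    (lattice d).Adj x y ↔ ∃ i, y = x + Pi.single i 1 ∨ y = x - Pi.single i 1 := by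
  change ∑ i, (x i - y i) ^ 2 = 1 ↔ _
  constructor
  · intro h
    obtain ⟨i, hi⟩ : ∃ i, (x i - y i) ^ 2 ≠ 0 := by
      by_contra! hc
      simp [hc] at h
    have hsplit := Finset.add_sum_erase Finset.univ (fun j => (x j - y j) ^ 2) (Finset.mem_univ i)
    have hrest : 0 ≤ ∑ j ∈ Finset.univ.erase i, (x j - y j) ^ 2 :=
      Finset.sum_nonneg fun j _ => sq_nonneg _
    have hpos : 0 < (x i - y i) ^ 2 := lt_of_le_of_ne (sq_nonneg _) (Ne.symm hi)
    have hone : (x i - y i) ^ 2 = 1 := by omega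
    have hzero : ∑ j ∈ Finset.univ.erase i, (x j - y j) ^ 2 = 0 := by omega
    rw [Finset.sum_eq_zero_iff_of_nonneg (fun j _ => sq_nonneg _)] at hzero
    have hoff : ∀ j, j ≠ i → y j = x j := fun j hj => by
      have := pow_eq_zero_iff (two_ne_zero) |>.1 (hzero j (by simp [hj]))
      omega
    refine ⟨i, ?_⟩
    rcases (mul_self_eq_one_iff.1 ((sq _).symm.trans hone)) with h1 | h1
    · right
      funext j
      by_cases hj : j = i
      · subst hj; simp; omega
      · simp [hj, hoff j hj]
    · left
      funext j
      by_cases hj : j = i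
      · subst hj; simp; omega
      · simp [hj, hoff j hj]
  · rintro ⟨i, rfl | rfl⟩
    · rw [Finset.sum_eq_single i] <;> simp +contextual
    · rw [Finset.sum_eq_single i] <;> simp +contextual

/-- The graph on `ℤ^d` that joins nearest neighbours of equal spin. -/
def equalSpinGraph {d : ℕ} (σ : Config d) : SimpleGraph (Site d) where
  Adj x y := (lattice d).Adj x y ∧ σ x = σ y
  symm := ⟨fun _ _ h => ⟨h.1.symm, h.2.symm⟩⟩
  loopless := ⟨fun _ h => h.1.ne rfl⟩

/-- The cluster `C_x(σ)`: all sites joined to `x` by a nearest-neighbour path of constant spin. -/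
def cluster {d : ℕ} (σ : Config d) (x : Site d) : Set (Site d) :=
  {y | (equalSpinGraph σ).Reachable x y}

/-- The cluster at `x` is the largest set of sites which contains `x`, is connected in the lattice,
and on which the spin is constant. -/
theorem cluster_isGreatest {d : ℕ} (σ : Config d) (x : Site d) :
    IsGreatest {S : Set (Site d) | x ∈ S ∧ ((lattice d).induce S).Preconnected ∧
      ∀ y ∈ S, ∀ z ∈ S, σ y = σ z} (cluster σ x) := by
  have hspin : ∀ y, y ∈ cluster σ x → σ x = σ y := by
    rintro y ⟨w⟩
    induction w with
    | nil => rfl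
    | cons h _ ih => exact h.2.trans ih
  have hx : x ∈ cluster σ x := SimpleGraph.Reachable.refl x
  refine ⟨⟨hx, ?_, fun y hy z hz => (hspin y hy).symm.trans (hspin z hz)⟩, ?_⟩
  · have key : ∀ (y z : Site d) (w : (equalSpinGraph σ).Walk y z)
        (hy : y ∈ cluster σ x) (hz : z ∈ cluster σ x),
        ((lattice d).induce (cluster σ x)).Reachable ⟨y, hy⟩ ⟨z, hz⟩ := by
      intro y z w
      induction w with
      | nil => intro _ _; exact SimpleGraph.Reachable.refl _
      | @cons a b c h _ ih =>
        intro hy hz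
        have hb : b ∈ cluster σ x := SimpleGraph.Reachable.trans hy h.reachable
        exact SimpleGraph.Reachable.trans
          (SimpleGraph.Adj.reachable (by exact h.1)) (ih hb hz)
    rintro ⟨y, hy⟩ ⟨z, hz⟩
    obtain ⟨w⟩ : (equalSpinGraph σ).Reachable y z :=
      SimpleGraph.Reachable.trans (SimpleGraph.Reachable.symm hy) hz
    exact key y z w hy hz
  · rintro S ⟨hxS, hconn, hconst⟩ y hyS
    obtain ⟨w⟩ := hconn ⟨x, hxS⟩ ⟨y, hyS⟩
    let f : (lattice d).induce S →g equalSpinGraph σ :=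
      ⟨fun v => v.1, fun {a b} h => ⟨h, hconst a.1 a.2 b.1 b.2⟩⟩
    exact ⟨w.map f⟩

/-- The change of energy `ΔH_x(σ) = 2 ∑_{y : ‖x - y‖ = 1} σ_x σ_y` that a flip of the spin at `x`
would cause (all couplings equal to one). -/
def energyChange {d : ℕ} (σ : Config d) (x : Site d) : ℤ :=
  2 * ∑ i, ((σ x : ℤ) * (σ (x + Pi.single i 1) : ℤ) + (σ x : ℤ) * (σ (x - Pi.single i 1) : ℤ))

/-- The spin at `x` after a clock ring at `x`, when `σ` is the configuration just before the ring:
it flips if that lowers the energy, does not flip if that raises the energy, and in case of a tie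
it flips exactly when the coin shows `true`. -/
def updatedSpin {d : ℕ} (σ : Config d) (x : Site d) (coin : Bool) : ℤˣ :=
  if energyChange σ x < 0 ∨ (energyChange σ x = 0 ∧ coin = true) then -σ x else σ x

/-- A realization of the dynamics: for every site `x` and every `n`, the waiting time between the
`n`-th and `(n+1)`-st clock ring at `x` (from time `0` if `n = 0`), and the coin tossed at the
`(n+1)`-st ring. -/
abbrev Dynamics (d : ℕ) : Type := Site d × ℕ → ℝ × Bool

/-- The law of the dynamics: all waiting times and coins are independent, the waiting times are
exponential of rate one (so that the rings at each site form a rate-one Poisson process, independent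
for different sites), and the coins are fair. -/
noncomputable def dynamicsLaw (d : ℕ) : Measure (Dynamics d) :=
  Measure.infinitePi fun _ : Site d × ℕ =>
    (expMeasure 1).prod (PMF.uniformOfFintype Bool).toMeasure

/-- The symmetric Bernoulli product measure on spin configurations. -/
noncomputable def symmetricBernoulli (d : ℕ) : Measure (Config d) :=
  Measure.infinitePi fun _ : Site d => (PMF.uniformOfFintype ℤˣ).toMeasure

/-- The sigma-algebra on the two spin values contains all subsets. -/
instance measurableSingletonClass_spin : MeasurableSingletonClass ℤˣ :=
  ⟨fun a => ⟨{(a : ℤ)}, trivial, by ext b; simp [Units.ext_iff]⟩⟩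

instance isProbabilityMeasure_dynamicsLaw (d : ℕ) : IsProbabilityMeasure (dynamicsLaw d) := by
  have : IsProbabilityMeasure (expMeasure 1) := isProbabilityMeasure_expMeasure one_pos
  unfold dynamicsLaw
  infer_instance

instance isProbabilityMeasure_symmetricBernoulli (d : ℕ) :
    IsProbabilityMeasure (symmetricBernoulli d) := by
  unfold symmetricBernoulli
  infer_instance

/-- Invariance of a measure on configurations under all translations of `ℤ^d`. -/
def IsTranslationInvariant {d : ℕ} (μ : Measure (Config d)) : Prop :=
  ∀ a : Site d, μ.map (fun (σ : Config d) (x : Site d) => σ (x + a)) = μ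

/-- The time of the `n`-th clock ring at `x`, where `n = 0, 1, 2, …`. -/
noncomputable def ringTime {d : ℕ} (θ : Dynamics d) (x : Site d) (n : ℕ) : ℝ :=
  ∑ k ∈ Finset.range (n + 1), (θ (x, k)).1

/-- `σ` is a trajectory of the zero-temperature dynamics with initial configuration `σ₀` and
realization `θ` of clock rings and coins. -/
structure IsTrajectory {d : ℕ} (σ₀ : Config d) (θ : Dynamics d) (σ : ℝ≥0 → Config d) : Prop where
  /-- The trajectory starts at `σ₀`. -/
  initial : σ 0 = σ₀
  /-- The spin at a site does not change in a time interval without a clock ring at that site. -/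
  constant : ∀ (x : Site d) (s t : ℝ≥0), s ≤ t →
    (∀ n, ringTime θ x n ∉ Set.Ioc (s : ℝ) (t : ℝ)) → σ t x = σ s x
  /-- At a clock ring at `x` the spin at `x` is updated from the configuration just before. -/
  ring : ∀ (x : Site d) (n : ℕ) (t : ℝ≥0), ringTime θ x n = (t : ℝ) →
    ∀ᶠ s in 𝓝[<] t, σ t x = updatedSpin (σ s) x (θ (x, n)).2

/-- The joint law of the initial configuration, of law `μ₀`, and of the independent dynamics. -/
noncomputable def jointLaw {d : ℕ} (μ₀ : Measure (Config d)) : Measure (Config d × Dynamics d) :=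
  μ₀.prod (dynamicsLaw d)

end ZeroTempIsing

open ZeroTempIsing

namespace ZeroTempIsing

variable {d : ℕ}

/-! ### Local dependence of the update rule -/

/-! The process is built from the graphical representation. A ring depends only on earlier rings in
its star, so the spin after a ring is computed by recursion along `Precedes`, and existence and
uniqueness of the trajectory reduce to `Precedes` being well-founded. This holds almost surely
(`ae_isGood`): in a short time interval the sites that ring form a subcritical site percolation, so
a backward chain of influences, whose times converge, would eventually be trapped in a finite box
that has only finitely many rings.

For the growth of the cluster, the first ingredient is an energy budget. Each flip is charged to the
site that flips. By translation invariance the mean gain in the bond products charged to one site up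
to time `t` is that of `d` bonds, each gaining at most 2, so the bound does not depend on `t`. Since
no ring raises the energy and a lowering ring yields at least one unit, the expected number of
lowering rings at a site is finite (`tsum_measure_lowering_ne_top`).

The second ingredient is a lower bound on conditional probabilities (`measure_le_nextRingAt`): for
an event that depends only on what happened up to a ring `p`, the chance that the next ring in a
finite set `B` is at a prescribed site with a prescribed coin is bounded below. It is obtained by
changing one waiting time or coin at a time, at bounded cost.

These combine by induction on `M` in `tsum_measure_smallCluster_ne_top`. A finite cluster has an
extremal site `x` where a flip does not raise the energy. If the next ring in a surrounding set `B`
is at `x` with coin `true`, then either the energy drops, or a tie is flipped and a neighbour that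
shared the spin of `x` is left in a cluster with one site fewer. Both outcomes happen finitely often
in expectation, hence so does the presence of a cluster of size at most `M + 1`. Borel–Cantelli
finishes the proof, since the relevant box is frozen between rings. -/

theorem lattice_adj_add (x : Site d) (i : Fin d) : (lattice d).Adj x (x + Pi.single i 1) :=
  (lattice_adj_iff _ _).2 ⟨i, Or.inl rfl⟩

theorem lattice_adj_sub (x : Site d) (i : Fin d) : (lattice d).Adj x (x - Pi.single i 1) :=
  (lattice_adj_iff _ _).2 ⟨i, Or.inr rfl⟩

theorem energyChange_congr {σ τ : Config d} {x : Site d} (hx : σ x = τ x)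
    (h : ∀ y, (lattice d).Adj x y → σ y = τ y) : energyChange σ x = energyChange τ x := by
  unfold energyChange
  congr 1
  refine Finset.sum_congr rfl fun i _ => ?_
  rw [hx, h _ (lattice_adj_add x i), h _ (lattice_adj_sub x i)]

theorem updatedSpin_congr {σ τ : Config d} {x : Site d} (hx : σ x = τ x)
    (h : ∀ y, (lattice d).Adj x y → σ y = τ y) (b : Bool) :
    updatedSpin σ x b = updatedSpin τ x b := by
  unfold updatedSpin
  rw [energyChange_congr hx h, hx]

/-- The finite set consisting of a site and its neighbours. -/
noncomputable def star (x : Site d) : Finset (Site d) :=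
  insert x (Finset.univ.image (fun i => x + Pi.single i 1) ∪
    Finset.univ.image (fun i => x - Pi.single i 1))

theorem mem_star {x y : Site d} : y ∈ star x ↔ y = x ∨ (lattice d).Adj x y := by
  rw [lattice_adj_iff]
  simp only [star, Finset.mem_insert, Finset.mem_union, Finset.mem_image, Finset.mem_univ,
    true_and]
  refine or_congr_right ⟨?_, ?_⟩
  · rintro (⟨i, h⟩ | ⟨i, h⟩)
    · exact ⟨i, Or.inl h.symm⟩
    · exact ⟨i, Or.inr h.symm⟩
  · rintro ⟨i, h | h⟩
    · exact Or.inl ⟨i, h.symm⟩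
    · exact Or.inr ⟨i, h.symm⟩

theorem updatedSpin_congr_star {σ τ : Config d} {x : Site d} (h : ∀ y ∈ star x, σ y = τ y)
    (b : Bool) : updatedSpin σ x b = updatedSpin τ x b :=
  updatedSpin_congr (h x (mem_star.2 (Or.inl rfl))) (fun y hy => h y (mem_star.2 (Or.inr hy))) b

/-! ### Ring times -/

/-- All waiting times are positive and the rings at each site do not accumulate. -/
structure IsRegular (θ : Dynamics d) : Prop where
  pos : ∀ q, 0 < (θ q).1
  unbounded : ∀ (x : Site d) (t : ℝ), ∃ n, t < ringTime θ x n

/-- The number of rings at `x` strictly before time `s`. -/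
noncomputable def ringsBefore (θ : Dynamics d) (x : Site d) (s : ℝ) : ℕ :=
  sInf {n | s ≤ ringTime θ x n}

/-- The number of rings at `x` up to and including time `t`. -/
noncomputable def ringsUpTo (θ : Dynamics d) (x : Site d) (t : ℝ) : ℕ :=
  sInf {n | t < ringTime θ x n}

theorem ringTime_succ (θ : Dynamics d) (x : Site d) (n : ℕ) :
    ringTime θ x (n + 1) = ringTime θ x n + (θ (x, n + 1)).1 := by
  unfold ringTime
  rw [Finset.sum_range_succ]

theorem ringTime_zero (θ : Dynamics d) (x : Site d) : ringTime θ x 0 = (θ (x, 0)).1 := by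
  simp [ringTime]

namespace IsRegular

variable {θ : Dynamics d} (h : IsRegular θ)
include h

theorem ringTime_strictMono (x : Site d) : StrictMono (ringTime θ x) :=
  strictMono_nat_of_lt_succ fun n => by
    rw [ringTime_succ]
    linarith [h.pos (x, n + 1)]

theorem ringTime_pos (x : Site d) (n : ℕ) : 0 < ringTime θ x n := by
  refine lt_of_lt_of_le ?_ ((h.ringTime_strictMono x).monotone (Nat.zero_le n))
  rw [ringTime_zero]
  exact h.pos _

theorem lt_ringsBefore {x : Site d} {s : ℝ} {n : ℕ} :
    n < ringsBefore θ x s ↔ ringTime θ x n < s := by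
  have hne : {n | s ≤ ringTime θ x n}.Nonempty := (h.unbounded x s).imp fun n hn => hn.le
  constructor
  · intro hn
    by_contra! hc
    exact absurd (Nat.sInf_le (s := {n | s ≤ ringTime θ x n}) hc) (not_le.2 hn)
  · intro hn
    by_contra! hc
    have h1 : s ≤ ringTime θ x (ringsBefore θ x s) := Nat.sInf_mem hne
    have h2 := (h.ringTime_strictMono x).monotone hc
    linarith

theorem lt_ringsUpTo {x : Site d} {t : ℝ} {n : ℕ} :
    n < ringsUpTo θ x t ↔ ringTime θ x n ≤ t := by
  have hne : {n | t < ringTime θ x n}.Nonempty := h.unbounded x t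
  constructor
  · intro hn
    by_contra! hc
    exact absurd (Nat.sInf_le (s := {n | t < ringTime θ x n}) hc) (not_le.2 hn)
  · intro hn
    by_contra! hc
    have h1 : t < ringTime θ x (ringsUpTo θ x t) := Nat.sInf_mem hne
    have h2 := (h.ringTime_strictMono x).monotone hc
    linarith

theorem ringsUpTo_eq_ringsUpTo {x : Site d} {s t : ℝ}
    (hst : ∀ n, ringTime θ x n ≤ s ↔ ringTime θ x n ≤ t) : ringsUpTo θ x s = ringsUpTo θ x t :=
  eq_of_forall_lt_iff fun n => by rw [h.lt_ringsUpTo, h.lt_ringsUpTo, hst]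

theorem ringsUpTo_eq_ringsBefore {x : Site d} {s t : ℝ}
    (hst : ∀ n, ringTime θ x n ≤ s ↔ ringTime θ x n < t) : ringsUpTo θ x s = ringsBefore θ x t :=
  eq_of_forall_lt_iff fun n => by rw [h.lt_ringsUpTo, h.lt_ringsBefore, hst]

theorem ringsBefore_ringTime (x : Site d) (n : ℕ) : ringsBefore θ x (ringTime θ x n) = n :=
  eq_of_forall_lt_iff fun m => by rw [h.lt_ringsBefore, (h.ringTime_strictMono x).lt_iff_lt]

theorem ringsUpTo_ringTime (x : Site d) (n : ℕ) : ringsUpTo θ x (ringTime θ x n) = n + 1 :=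
  eq_of_forall_lt_iff fun m => by
    rw [h.lt_ringsUpTo, (h.ringTime_strictMono x).le_iff_le, Nat.lt_succ_iff]

theorem lt_ringTime_ringsUpTo (x : Site d) (t : ℝ) : t < ringTime θ x (ringsUpTo θ x t) :=
  Nat.sInf_mem (s := {n | t < ringTime θ x n}) (h.unbounded x t)

theorem ringsUpTo_zero (x : Site d) : ringsUpTo θ x 0 = 0 :=
  eq_of_forall_lt_iff fun n => by
    rw [h.lt_ringsUpTo]
    simpa using h.ringTime_pos x n

theorem finite_setOf_ringTime_le (x : Site d) (t : ℝ) : {n | ringTime θ x n ≤ t}.Finite :=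
  (Set.finite_lt_nat (ringsUpTo θ x t)).subset fun _ hn => h.lt_ringsUpTo.2 hn

end IsRegular

/-! ### Picard approximation of the dynamics -/

/-- The spin at a site after a given number of rings there, where the dependence on earlier rings
is followed back for a limited number of steps only. -/
noncomputable def approxSpin (θ : Dynamics d) (σ₀ : Config d) : ℕ → Site d → ℕ → ℤˣ
  | 0, x, _ => σ₀ x
  | _ + 1, x, 0 => σ₀ x
  | K + 1, x, n + 1 =>
    updatedSpin (fun z => approxSpin θ σ₀ K z (ringsBefore θ z (ringTime θ x n))) x (θ (x, n)).2

open Classical in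
/-- The spin at `x` after `n` rings at `x`. -/
noncomputable def spinAfter (θ : Dynamics d) (σ₀ : Config d) (x : Site d) (n : ℕ) : ℤˣ :=
  if ∀ᶠ K in atTop, approxSpin θ σ₀ K x n = 1 then 1 else -1

/-- The configuration at time `t`. -/
noncomputable def stateAt (θ : Dynamics d) (σ₀ : Config d) (t : ℝ) : Config d :=
  fun x => spinAfter θ σ₀ x (ringsUpTo θ x t)

/-- The configuration just before time `t`. -/
noncomputable def stateBefore (θ : Dynamics d) (σ₀ : Config d) (t : ℝ) : Config d :=
  fun x => spinAfter θ σ₀ x (ringsBefore θ x t)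

/-- The ring `p` precedes the ring `q` and is close enough to influence it directly. -/
def Precedes (θ : Dynamics d) (p q : Site d × ℕ) : Prop :=
  p.1 ∈ star q.1 ∧ ringTime θ p.1 p.2 < ringTime θ q.1 q.2

theorem approxSpin_zero_right (θ : Dynamics d) (σ₀ : Config d) (K : ℕ) (x : Site d) :
    approxSpin θ σ₀ K x 0 = σ₀ x := by
  cases K <;> simp [approxSpin]

theorem spinAfter_eq_of_eventually {θ : Dynamics d} {σ₀ : Config d} {x : Site d} {n : ℕ} {v : ℤˣ}
    (h : ∀ᶠ K in atTop, approxSpin θ σ₀ K x n = v) : spinAfter θ σ₀ x n = v := by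
  unfold spinAfter
  split_ifs with h1
  · obtain ⟨K, h2, h3⟩ := (h.and h1).exists
    exact h3.symm.trans h2
  · rcases Int.units_eq_one_or v with rfl | rfl
    · exact absurd h h1
    · rfl

theorem spinAfter_congr {θ θ' : Dynamics d} {σ₀ σ₀' : Config d} {x x' : Site d} {n n' : ℕ}
    (h : ∀ K, approxSpin θ σ₀ K x n = approxSpin θ' σ₀' K x' n') :
    spinAfter θ σ₀ x n = spinAfter θ' σ₀' x' n' := by
  classical
  unfold spinAfter
  exact if_congr (eventually_congr (.of_forall fun K => by rw [h K])) rfl rfl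

theorem spinAfter_zero (θ : Dynamics d) (σ₀ : Config d) (x : Site d) :
    spinAfter θ σ₀ x 0 = σ₀ x :=
  spinAfter_eq_of_eventually (.of_forall fun K => approxSpin_zero_right θ σ₀ K x)

/-- Well-founded induction on rings: one more iteration consults only the finitely many sites of a
star, each at a ring that precedes the present one, and there the iterates have already stabilized.
-/
theorem eventually_approxSpin_eq {θ : Dynamics d} (h : IsRegular θ)
    (hwf : WellFounded (Precedes θ)) (σ₀ : Config d) (x : Site d) (n : ℕ) :
    ∀ᶠ K in atTop, approxSpin θ σ₀ K x n = spinAfter θ σ₀ x n := by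
  suffices H : ∃ v, ∀ᶠ K in atTop, approxSpin θ σ₀ K x n = v by
    obtain ⟨v, hv⟩ := H
    rwa [spinAfter_eq_of_eventually hv]
  cases n with
  | zero => exact ⟨σ₀ x, .of_forall fun K => approxSpin_zero_right θ σ₀ K x⟩
  | succ n =>
    suffices H : ∀ p : Site d × ℕ, ∃ v, ∀ᶠ K in atTop, approxSpin θ σ₀ K p.1 (p.2 + 1) = v from
      H (x, n)
    intro p
    induction p using hwf.induction with
    | _ p ih =>
      -- The membership hypothesis sits behind the existential so that `choose` yields a full
      -- configuration; its values off the star (set to `1`) are never read.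
      have key : ∀ z, ∃ v, z ∈ star p.1 → ∀ᶠ K in atTop,
          approxSpin θ σ₀ K z (ringsBefore θ z (ringTime θ p.1 p.2)) = v := by
        intro z
        by_cases hz : z ∈ star p.1
        · rcases hm : ringsBefore θ z (ringTime θ p.1 p.2) with _ | m
          · exact ⟨σ₀ z, fun _ => .of_forall fun K => approxSpin_zero_right θ σ₀ K z⟩
          · obtain ⟨v, hv⟩ := ih (z, m) ⟨hz, h.lt_ringsBefore.1 (hm ▸ Nat.lt_succ_self m)⟩
            exact ⟨v, fun _ => hv⟩
        · exact ⟨1, fun h => absurd h hz⟩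
      choose τ hτ using key
      refine ⟨updatedSpin τ p.1 (θ p).2, ?_⟩
      have hall : ∀ᶠ K in atTop, ∀ z ∈ star p.1,
          approxSpin θ σ₀ K z (ringsBefore θ z (ringTime θ p.1 p.2)) = τ z :=
        (Finset.eventually_all _).2 fun z hz => hτ z hz
      obtain ⟨K₀, hK₀⟩ := eventually_atTop.1 hall
      refine eventually_atTop.2 ⟨K₀ + 1, fun K hK => ?_⟩
      obtain ⟨K, rfl⟩ : ∃ k, K = k + 1 := ⟨K - 1, by omega⟩
      rw [approxSpin]
      exact updatedSpin_congr_star (hK₀ K (by omega)) _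

theorem spinAfter_succ {θ : Dynamics d} (h : IsRegular θ)
    (hwf : WellFounded (Precedes θ)) (σ₀ : Config d) (x : Site d) (n : ℕ) :
    spinAfter θ σ₀ x (n + 1) =
      updatedSpin (stateBefore θ σ₀ (ringTime θ x n)) x (θ (x, n)).2 := by
  apply spinAfter_eq_of_eventually
  have hall : ∀ᶠ K in atTop, ∀ z ∈ star x,
      approxSpin θ σ₀ K z (ringsBefore θ z (ringTime θ x n)) =
        stateBefore θ σ₀ (ringTime θ x n) z :=
    (Finset.eventually_all _).2 fun z _ => eventually_approxSpin_eq h hwf σ₀ z _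
  obtain ⟨K₀, hK₀⟩ := eventually_atTop.1 hall
  refine eventually_atTop.2 ⟨K₀ + 1, fun K hK => ?_⟩
  obtain ⟨K, rfl⟩ : ∃ k, K = k + 1 := ⟨K - 1, by omega⟩
  rw [approxSpin]
  exact updatedSpin_congr_star (hK₀ K (by omega)) _

/-! ### Existence and uniqueness of the trajectory -/

/-- Just before time `t`, the count of rings at `x` equals the count of rings strictly before `t`. -/
theorem IsRegular.eventually_ringsUpTo_eq {θ : Dynamics d} (h : IsRegular θ) (x : Site d)
    (t : ℝ≥0) : ∀ᶠ s : ℝ≥0 in 𝓝[<] t, ringsUpTo θ x s = ringsBefore θ x t := by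
  have hfin := h.finite_setOf_ringTime_le x t
  have hev : ∀ᶠ s : ℝ≥0 in 𝓝[<] t, ∀ n ∈ {n | ringTime θ x n ≤ t},
      ringTime θ x n < t → ringTime θ x n ≤ s := by
    rw [eventually_all_finite hfin]
    intro n _
    by_cases hn : ringTime θ x n < t
    · have : ∀ᶠ s : ℝ≥0 in 𝓝 t, ringTime θ x n < (s : ℝ) :=
        (NNReal.continuous_coe.tendsto t).eventually (lt_mem_nhds hn)
      filter_upwards [nhdsWithin_le_nhds this] with s hs _ using hs.le
    · exact .of_forall fun s hc => absurd hc hn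
  filter_upwards [hev, self_mem_nhdsWithin] with s hs hst
  have hst' : (s : ℝ) < t := NNReal.coe_lt_coe.2 hst
  exact h.ringsUpTo_eq_ringsBefore fun n =>
    ⟨fun hn => hn.trans_lt hst', fun hn => hs n hn.le hn⟩

theorem isTrajectory_stateAt {θ : Dynamics d} (h : IsRegular θ) (hwf : WellFounded (Precedes θ))
    (σ₀ : Config d) : IsTrajectory σ₀ θ fun t => stateAt θ σ₀ t where
  initial := by
    funext x
    simp [stateAt, h.ringsUpTo_zero, spinAfter_zero]
  constant x s t hst hno := by
    have : ringsUpTo θ x t = ringsUpTo θ x s := h.ringsUpTo_eq_ringsUpTo fun n => by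
      have := hno n
      have hst' : (s : ℝ) ≤ t := hst
      constructor
      · intro hn
        by_contra! hc
        exact this ⟨hc, hn⟩
      · intro hn
        exact hn.trans hst'
    simp [stateAt, this]
  ring x n t ht := by
    have hev : ∀ᶠ s : ℝ≥0 in 𝓝[<] t, ∀ z ∈ star x, ringsUpTo θ z s = ringsBefore θ z t :=
      (Finset.eventually_all _).2 fun z _ => h.eventually_ringsUpTo_eq z t
    filter_upwards [hev] with s hs
    have h1 : ringsUpTo θ x (t : ℝ) = n + 1 := by rw [← ht, h.ringsUpTo_ringTime]
    simp only [stateAt, h1]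
    rw [spinAfter_succ h hwf, ht]
    refine updatedSpin_congr_star (fun z hz => ?_) _
    simp only [stateBefore, ← hs z hz]; rfl

/-- The rules express the spin after a ring through spins left by preceding rings, so the recursion
that constructs the process also determines every trajectory. -/
theorem IsTrajectory.eq_stateAt {θ : Dynamics d} (h : IsRegular θ)
    (hwf : WellFounded (Precedes θ)) {σ₀ : Config d} {σ : ℝ≥0 → Config d}
    (hσ : IsTrajectory σ₀ θ σ) : σ = fun t : ℝ≥0 => stateAt θ σ₀ t := by
  have hzero : ∀ x (t : ℝ≥0), ringsUpTo θ x t = 0 → σ t x = σ₀ x := by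
    intro x t ht
    rw [hσ.constant x 0 t zero_le, hσ.initial]
    intro n hn
    have := h.lt_ringsUpTo.2 hn.2
    omega
  have hsucc : ∀ p : Site d × ℕ, ∀ t : ℝ≥0, ringsUpTo θ p.1 t = p.2 + 1 →
      σ t p.1 = spinAfter θ σ₀ p.1 (p.2 + 1) := by
    intro p
    induction p using hwf.induction with
    | _ p ih =>
      intro t ht
      obtain ⟨x, n⟩ := p
      simp only at ht ⊢
      set r : ℝ≥0 := ⟨ringTime θ x n, (h.ringTime_pos x n).le⟩ with hr
      have hrt : r ≤ t := NNReal.coe_le_coe.1 (h.lt_ringsUpTo.1 (by omega))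
      have h1 : σ t x = σ r x := hσ.constant x r t hrt fun m hm => by
        have hm1 : n < m := (h.ringTime_strictMono x).lt_iff_lt.1 hm.1
        have hm2 := h.lt_ringsUpTo.2 hm.2
        omega
      have h2 := hσ.ring x n r rfl
      have hr0 : 0 < r := h.ringTime_pos x n
      -- Ring times are positive, so the left neighbourhood is nontrivial in `ℝ≥0` and an actual
      -- time `s` just before the ring can be extracted.
      have hne : (𝓝[<] r).NeBot := nhdsLT_neBot_of_exists_lt ⟨0, hr0⟩
      have hev : ∀ᶠ s : ℝ≥0 in 𝓝[<] r, ∀ z ∈ star x, ringsUpTo θ z s = ringsBefore θ z r :=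
        (Finset.eventually_all _).2 fun z _ => h.eventually_ringsUpTo_eq z r
      obtain ⟨s, hs1, hs2⟩ := (h2.and hev).exists
      rw [h1, hs1, spinAfter_succ h hwf]
      refine updatedSpin_congr_star (fun z hz => ?_) _
      have hs3 := hs2 z hz
      simp only [stateBefore]
      change σ s z = spinAfter θ σ₀ z (ringsBefore θ z r)
      rcases hm : ringsBefore θ z r with _ | m
      · rw [hzero z s (by rw [hs3, hm]), spinAfter_zero]
      · exact ih (z, m) ⟨hz, h.lt_ringsBefore.1 (hm ▸ Nat.lt_succ_self m)⟩ s
          (by simp [hs3, hm])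
  funext t x
  simp only [stateAt]
  rcases hm : ringsUpTo θ x t with _ | m
  · rw [hzero x t hm, spinAfter_zero]
  · exact hsucc (x, m) t hm

/-! ### Dependence on the past only, and translations -/

/-- `θ` and `θ'` have the same rings and coins up to time `t`. -/
def AgreeUpTo (t : ℝ) (θ θ' : Dynamics d) : Prop :=
  ∀ x n, ringTime θ x n ≤ t ∨ ringTime θ' x n ≤ t →
    ringTime θ x n = ringTime θ' x n ∧ (θ (x, n)).2 = (θ' (x, n)).2

theorem AgreeUpTo.ringsBefore_eq {t : ℝ} {θ θ' : Dynamics d} (h : IsRegular θ) (h' : IsRegular θ')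
    (hag : AgreeUpTo t θ θ') {s : ℝ} (hs : s ≤ t) (x : Site d) :
    ringsBefore θ x s = ringsBefore θ' x s :=
  eq_of_forall_lt_iff fun n => by
    rw [h.lt_ringsBefore, h'.lt_ringsBefore]
    constructor
    · intro hn
      rwa [← (hag x n (Or.inl (hn.le.trans hs))).1]
    · intro hn
      rwa [(hag x n (Or.inr (hn.le.trans hs))).1]

theorem AgreeUpTo.ringsUpTo_eq {t : ℝ} {θ θ' : Dynamics d} (h : IsRegular θ) (h' : IsRegular θ')
    (hag : AgreeUpTo t θ θ') (x : Site d) : ringsUpTo θ x t = ringsUpTo θ' x t :=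
  eq_of_forall_lt_iff fun n => by
    rw [h.lt_ringsUpTo, h'.lt_ringsUpTo]
    constructor
    · intro hn
      rwa [← (hag x n (Or.inl hn)).1]
    · intro hn
      rwa [(hag x n (Or.inr hn)).1]

theorem AgreeUpTo.approxSpin_eq {t : ℝ} {θ θ' : Dynamics d} (h : IsRegular θ) (h' : IsRegular θ')
    (hag : AgreeUpTo t θ θ') (σ₀ : Config d) (K : ℕ) :
    ∀ x n, n ≤ ringsUpTo θ x t → approxSpin θ σ₀ K x n = approxSpin θ' σ₀ K x n := by
  induction K with
  | zero => intro x n _; simp [approxSpin]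
  | succ K ih =>
    intro x n hn
    cases n with
    | zero => simp [approxSpin]
    | succ n =>
      have hT : ringTime θ x n ≤ t := h.lt_ringsUpTo.1 hn
      obtain ⟨h1, h2⟩ := hag x n (Or.inl hT)
      rw [approxSpin, approxSpin, ← h1, ← h2]
      congr 1
      funext z
      rw [← hag.ringsBefore_eq h h' hT z]
      refine ih _ _ (Nat.le_of_not_lt fun hc => ?_)
      have h3 := h.lt_ringsBefore.1 hc
      have h4 := h.lt_ringTime_ringsUpTo z t
      linarith

/-- Equality holds iterate by iterate, so convergence of the iterates is not needed. Regularity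
suffices, which is why later events can be insensitive to a change of the future without any appeal
to well-foundedness. -/
theorem AgreeUpTo.stateAt_eq {t : ℝ} {θ θ' : Dynamics d} (h : IsRegular θ) (h' : IsRegular θ')
    (hag : AgreeUpTo t θ θ') (σ₀ : Config d) : stateAt θ σ₀ t = stateAt θ' σ₀ t := by
  funext x
  simp only [stateAt, ← hag.ringsUpTo_eq h h' x]
  exact spinAfter_congr fun K => hag.approxSpin_eq h h' σ₀ K x _ le_rfl

/-- The translate of a configuration. -/
def translateConfig (a : Site d) (σ : Config d) : Config d := fun x => σ (x + a)

/-- The translate of a realization of the dynamics. -/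
def translateDynamics (a : Site d) (θ : Dynamics d) : Dynamics d := fun q => θ (q.1 + a, q.2)

theorem energyChange_translate (a : Site d) (σ : Config d) (x : Site d) :
    energyChange (translateConfig a σ) x = energyChange σ (x + a) := by
  simp only [energyChange, translateConfig, add_right_comm, sub_add_eq_add_sub]

theorem updatedSpin_translate (a : Site d) (σ : Config d) (x : Site d) (b : Bool) :
    updatedSpin (translateConfig a σ) x b = updatedSpin σ (x + a) b := by
  simp only [updatedSpin, energyChange_translate]
  rfl

theorem approxSpin_translate (a : Site d) (θ : Dynamics d) (σ₀ : Config d) (K : ℕ) :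
    ∀ x n, approxSpin (translateDynamics a θ) (translateConfig a σ₀) K x n =
      approxSpin θ σ₀ K (x + a) n := by
  induction K with
  | zero => intro x n; simp [approxSpin, translateConfig]
  | succ K ih =>
    intro x n
    cases n with
    | zero => simp [approxSpin, translateConfig]
    | succ n =>
      simp only [approxSpin, ih]
      exact updatedSpin_translate a
        (fun z => approxSpin θ σ₀ K z (ringsBefore θ z (ringTime θ (x + a) n))) x _

theorem spinAfter_translate (a : Site d) (θ : Dynamics d) (σ₀ : Config d) (x : Site d) (n : ℕ) :
    spinAfter (translateDynamics a θ) (translateConfig a σ₀) x n = spinAfter θ σ₀ (x + a) n :=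
  spinAfter_congr fun K => approxSpin_translate a θ σ₀ K x n

/-! ### Clusters -/

theorem self_mem_cluster (σ : Config d) (z : Site d) : z ∈ cluster σ z :=
  SimpleGraph.Reachable.refl z

theorem spin_eq_of_mem_cluster {σ : Config d} {z y : Site d} (hy : y ∈ cluster σ z) :
    σ y = σ z :=
  (cluster_isGreatest σ z).1.2.2 y hy z (self_mem_cluster σ z)

theorem mem_cluster_of_adj {σ : Config d} {z a b : Site d} (ha : a ∈ cluster σ z)
    (hab : (lattice d).Adj a b) (hs : σ a = σ b) : b ∈ cluster σ z :=
  SimpleGraph.Reachable.trans ha (SimpleGraph.Adj.reachable (G := equalSpinGraph σ) ⟨hab, hs⟩)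

theorem cluster_subset_of_closed {σ : Config d} {w : Site d} {D : Set (Site d)} (hw : w ∈ D)
    (hD : ∀ a ∈ D, ∀ b, (lattice d).Adj a b → σ a = σ b → b ∈ D) : cluster σ w ⊆ D := by
  rintro y ⟨p⟩
  induction p with
  | nil => exact hw
  | cons h _ ih => exact ih (hD _ hw _ h.1 h.2)

/-- Agreement on the cluster and its outer boundary means that the boundary still has the opposite
spin, so no path of constant spin can leave. -/
theorem cluster_subset_of_eqOn {σ τ : Config d} {z : Site d}
    (h : ∀ a ∈ cluster σ z, ∀ b ∈ star a, σ b = τ b) : cluster τ z ⊆ cluster σ z := by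
  refine cluster_subset_of_closed (self_mem_cluster σ z) fun a ha b hab hs => ?_
  refine mem_cluster_of_adj ha hab ?_
  rw [h a ha a (mem_star.2 (Or.inl rfl)), h a ha b (mem_star.2 (Or.inr hab)), hs]

/-- The sites at sup-distance at most `M` from `z`. -/
noncomputable def box (z : Site d) (M : ℕ) : Finset (Site d) :=
  Finset.Icc (fun i => z i - M) (fun i => z i + M)

theorem mem_box {z y : Site d} {M : ℕ} : y ∈ box z M ↔ ∀ i, |y i - z i| ≤ M := by
  simp only [box, Finset.mem_Icc, Pi.le_def, abs_le]
  constructor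
  · rintro ⟨h1, h2⟩ i
    constructor <;> linarith [h1 i, h2 i]
  · intro h
    constructor <;> intro i <;> linarith [(h i).1, (h i).2]

theorem abs_sub_le_one_of_mem_star {a b : Site d} (h : b ∈ star a) (i : Fin d) :
    |b i - a i| ≤ 1 := by
  rcases mem_star.1 h with rfl | h
  · simp
  · obtain ⟨j, rfl | rfl⟩ := (lattice_adj_iff _ _).1 h <;>
    · rcases eq_or_ne i j with rfl | hij
      · simp
      · simp [hij]

theorem abs_sub_le_length {G : SimpleGraph (Site d)} (hG : G ≤ lattice d) {z y : Site d}
    (p : G.Walk z y) (i : Fin d) : |y i - z i| ≤ p.length := by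
  induction p with
  | nil => simp
  | @cons a b c h p ih =>
    have h1 := abs_sub_le_one_of_mem_star (mem_star.2 (Or.inr (hG h))) i
    have h2 := abs_sub_le (c i) (b i) (a i)
    rw [SimpleGraph.Walk.length_cons]
    push_cast
    linarith

/-- A self-avoiding path inside the cluster visits at most `M` sites and so has at most `M - 1`
steps; the remaining unit of distance covers the neighbours. -/
theorem star_subset_box {σ : Config d} {z y : Site d} {M : ℕ}
    (hM : (cluster σ z).encard ≤ M) (hy : y ∈ cluster σ z) : star y ⊆ box z M := by
  classical
  intro b hb
  obtain ⟨p, hp⟩ := SimpleGraph.Reachable.exists_isPath hy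
  have hsub : ((p.support.toFinset : Finset (Site d)) : Set (Site d)) ⊆ cluster σ z := by
    intro v hv
    have hv' : v ∈ p.support := by simpa using hv
    exact (p.takeUntil v hv').reachable
  have hcard : p.support.toFinset.card = p.length + 1 := by
    rw [List.toFinset_card_of_nodup hp.support_nodup, SimpleGraph.Walk.length_support]
  have hlen : p.length + 1 ≤ M := by
    have := (Set.encard_le_encard hsub).trans hM
    rw [Set.encard_coe_eq_coe_finsetCard, hcard] at this
    exact_mod_cast this
  rw [mem_box]
  intro i
  have h1 := abs_sub_le_length (G := equalSpinGraph σ) (fun _ _ h => h.1) p i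
  have h2 := abs_sub_le_one_of_mem_star hb i
  have h3 := abs_sub_le (b i) (y i) (z i)
  have h4 : (p.length : ℤ) + 1 ≤ M := by exact_mod_cast hlen
  linarith

theorem cluster_finite {σ : Config d} {z : Site d} {M : ℕ}
    (hM : (cluster σ z).encard ≤ M) : (cluster σ z).Finite :=
  Set.finite_of_encard_le_coe hM

/-- Small clusters are not affected by changes outside of a box. -/
theorem encard_cluster_le_of_eqOn_box {σ τ : Config d} {z : Site d} {M : ℕ}
    (hM : (cluster σ z).encard ≤ M) (h : ∀ b ∈ box z M, σ b = τ b) :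
    (cluster τ z).encard ≤ M :=
  (Set.encard_le_encard (cluster_subset_of_eqOn fun _ ha b hb =>
    h b (star_subset_box hM ha hb))).trans hM

theorem spin_mul_eq (a b : ℤˣ) : (a : ℤ) * (b : ℤ) = if a = b then 1 else -1 := by
  rcases Int.units_eq_one_or a with rfl | rfl <;> rcases Int.units_eq_one_or b with rfl | rfl <;>
    decide

/-- A finite cluster contains a site at which a flip does not raise the energy. -/
theorem exists_energyChange_nonpos {σ : Config d} {z : Site d} (hfin : (cluster σ z).Finite) :
    ∃ x ∈ cluster σ z, energyChange σ x ≤ 0 := by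
  -- A site maximizing the coordinate sum has every `x + e_i` outside the cluster, hence of opposite
  -- spin. In each direction the term of `x + e_i` is then `-1` and cancels at least the term of `x
  -- - e_i`.
  obtain ⟨x, hx, hmax⟩ := Set.exists_max_image (cluster σ z) (fun y => ∑ i, y i) hfin
    ⟨z, self_mem_cluster σ z⟩
  refine ⟨x, hx, ?_⟩
  unfold energyChange
  refine mul_nonpos_of_nonneg_of_nonpos (by norm_num) (Finset.sum_nonpos fun i _ => ?_)
  have h1 : σ x ≠ σ (x + Pi.single i 1) := by
    intro h
    have h2 := hmax _ (mem_cluster_of_adj hx (lattice_adj_add x i) h)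
    simp [Finset.sum_add_distrib] at h2
  rw [spin_mul_eq, spin_mul_eq, if_neg h1]
  split_ifs <;> simp

/-- At a site where a flip does not change the energy, some neighbour has the same spin. -/
theorem exists_adj_eq_of_energyChange_eq_zero (hd : 1 ≤ d) {σ : Config d} {x : Site d}
    (h0 : energyChange σ x = 0) : ∃ w, (lattice d).Adj x w ∧ σ x = σ w := by
  by_contra! hc
  have hsum : ∀ i ∈ (Finset.univ : Finset (Fin d)), ((σ x : ℤ) * (σ (x + Pi.single i 1) : ℤ) +
      (σ x : ℤ) * (σ (x - Pi.single i 1) : ℤ)) = -2 := fun i _ => by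
    rw [spin_mul_eq, spin_mul_eq, if_neg (hc _ (lattice_adj_add x i)),
      if_neg (hc _ (lattice_adj_sub x i))]
    norm_num
  unfold energyChange at h0
  rw [Finset.sum_congr rfl hsum] at h0
  simp at h0
  omega

/-- Flipping a spin of a cluster leaves smaller clusters. -/
theorem encard_cluster_le_of_flip {σ τ : Config d} {z x w : Site d} {M : ℕ}
    (hM : (cluster σ z).encard ≤ (M + 1 : ℕ)) (hx : x ∈ cluster σ z) (hw : w ∈ cluster σ z)
    (hwx : w ≠ x) (hflip : τ x = -σ x) (h : ∀ b ∈ box z (M + 1), b ≠ x → σ b = τ b) :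
    (cluster τ w).encard ≤ M := by
  -- The old cluster without `x` is closed under the new adjacency: `x` now has the spin opposite to
  -- the rest, and the outer boundary is unchanged.
  have hsub : cluster τ w ⊆ cluster σ z \ {x} := by
    refine cluster_subset_of_closed ⟨hw, hwx⟩ fun a ha b hab hs => ?_
    have ha1 : σ a = τ a :=
      h a (star_subset_box hM ha.1 (mem_star.2 (Or.inl rfl))) ha.2
    have hbx : b ≠ x := by
      rintro rfl
      rw [← ha1, hflip, spin_eq_of_mem_cluster ha.1, spin_eq_of_mem_cluster hx] at hs
      rcases Int.units_eq_one_or (σ z) with h1 | h1 <;> rw [h1] at hs <;> exact absurd hs (by decide)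
    have hb1 : σ b = τ b := h b (star_subset_box hM ha.1 (mem_star.2 (Or.inr hab))) hbx
    exact ⟨mem_cluster_of_adj ha.1 hab (by rw [ha1, hs, hb1]), hbx⟩
  have h1 := Set.encard_sdiff_singleton_add_one hx
  have h2 : (cluster σ z \ {x}).encard + 1 ≤ (M : ℕ∞) + 1 := by
    rw [h1]
    exact_mod_cast hM
  exact (Set.encard_le_encard hsub).trans ((ENat.add_le_add_iff_right (by simp)).1 h2)

/-! ### The law of a single waiting time and coin -/

theorem expMeasure_one_apply {F : Set ℝ} (hF : MeasurableSet F) :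
    expMeasure 1 F = ∫⁻ v, F.indicator (exponentialPDF 1) v := by
  rw [expMeasure, gammaMeasure, withDensity_apply _ hF, lintegral_indicator hF]
  rfl

theorem measurable_exponentialPDF_one : Measurable (exponentialPDF 1) :=
  (measurable_exponentialPDFReal 1).ennreal_ofReal

instance nullSingletonClass_expMeasure : NullSingletonClass (expMeasure 1) := by
  unfold expMeasure gammaMeasure
  infer_instance

instance isProbabilityMeasure_expMeasure_one : IsProbabilityMeasure (expMeasure 1) :=
  isProbabilityMeasure_expMeasure one_pos

theorem expMeasure_one_Iic_zero : expMeasure 1 (Set.Iic 0) = 0 := by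
  rw [← Set.Iio_union_right, measure_union_null_iff]
  refine ⟨?_, measure_singleton 0⟩
  rw [expMeasure, gammaMeasure, withDensity_apply _ measurableSet_Iio]
  exact lintegral_exponentialPDF_of_nonpos le_rfl

/-- Lebesgue measure is shift invariant and `e^{-v} = e^c e^{-(v+c)}`. The restriction `0 < v + c`
keeps the shifted point in the region where the density is this exponential, also when `c` is
negative. -/
theorem expMeasure_one_shift_le (c : ℝ) {F : Set ℝ} (hF : MeasurableSet F) :
    expMeasure 1 {v | 0 < v + c ∧ v + c ∈ F} ≤ ENNReal.ofReal (Real.exp c) * expMeasure 1 F := by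
  have hm : MeasurableSet {v : ℝ | 0 < v + c ∧ v + c ∈ F} :=
    (measurableSet_lt measurable_const (measurable_add_const c)).inter (measurable_add_const c hF)
  rw [expMeasure_one_apply hm, expMeasure_one_apply hF,
    ← lintegral_const_mul _ (measurable_exponentialPDF_one.indicator hF),
    ← lintegral_add_right_eq_self (fun v => _ * F.indicator (exponentialPDF 1) v) c]
  refine lintegral_mono fun v => ?_
  by_cases hv : 0 < v + c ∧ v + c ∈ F
  · rw [Set.indicator_of_mem (show v ∈ {v : ℝ | 0 < v + c ∧ v + c ∈ F} from hv),
      Set.indicator_of_mem hv.2, exponentialPDF_of_nonneg hv.1.le, exponentialPDF_eq,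
      ← ENNReal.ofReal_mul (Real.exp_pos c).le]
    apply ENNReal.ofReal_le_ofReal
    split_ifs
    · rw [one_mul, one_mul, one_mul, one_mul, ← Real.exp_add]
      exact (Real.exp_le_exp.2 (by linarith))
    · positivity
  · rw [Set.indicator_of_notMem (show v ∉ {v : ℝ | 0 < v + c ∧ v + c ∈ F} from hv)]
    exact zero_le

/-- The law of a waiting time and the coin at its end. -/
noncomputable abbrev ringLaw : Measure (ℝ × Bool) :=
  (expMeasure 1).prod (PMF.uniformOfFintype Bool).toMeasure

theorem ringLaw_preimage_fst (s : Set ℝ) : ringLaw (Prod.fst ⁻¹' s) = expMeasure 1 s := by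
  rw [← Set.prod_univ, Measure.prod_prod, measure_univ, mul_one]

theorem ringLaw_shift_le (c : ℝ) {F : Set (ℝ × Bool)} (hF : MeasurableSet F) :
    ringLaw {v | 0 < v.1 + c ∧ (v.1 + c, v.2) ∈ F} ≤ ENNReal.ofReal (Real.exp c) * ringLaw F := by
  have hm : MeasurableSet {v : ℝ × Bool | 0 < v.1 + c ∧ (v.1 + c, v.2) ∈ F} := by
    refine (measurableSet_lt (g := fun v : ℝ × Bool => v.1 + c) measurable_const
      (by fun_prop)).inter ?_
    exact (show Measurable fun v : ℝ × Bool => (v.1 + c, v.2) by fun_prop) hF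
  rw [Measure.prod_apply_symm hm, Measure.prod_apply_symm hF,
    ← lintegral_const_mul _ (measurable_measure_prodMk_right hF)]
  exact lintegral_mono fun b => expMeasure_one_shift_le c (measurable_prodMk_right hF)

theorem measurePreserving_not_uniform :
    MeasurePreserving (fun b : Bool => !b) (PMF.uniformOfFintype Bool).toMeasure
      (PMF.uniformOfFintype Bool).toMeasure := by
  refine ⟨measurable_of_finite _, ?_⟩
  refine Measure.ext_of_singleton fun b => ?_
  rw [Measure.map_apply (measurable_of_finite _) (measurableSet_singleton b)]
  have : (fun b : Bool => !b) ⁻¹' {b} = {!b} := by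
    ext x; cases x <;> cases b <;> simp
  rw [this, PMF.toMeasure_apply_singleton _ _ (measurableSet_singleton _),
    PMF.toMeasure_apply_singleton _ _ (measurableSet_singleton _)]
  simp

theorem ringLaw_flip {F : Set (ℝ × Bool)} (hF : MeasurableSet F) :
    ringLaw {v | (v.1, !v.2) ∈ F} = ringLaw F :=
  ((MeasurePreserving.id (expMeasure 1)).prod measurePreserving_not_uniform).measure_preimage
    hF.nullMeasurableSet

/-! ### Resampling one waiting time and coin -/

/-- By independence, overwriting one coordinate with a fresh copy preserves the law; this is checked
on finite cylinders. It reduces every later estimate that concerns one ring to an integral over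
`ringLaw`. -/
theorem dynamicsLaw_resample (q : Site d × ℕ) :
    (ringLaw.prod (dynamicsLaw d)).map (fun p => Function.update p.2 q p.1) = dynamicsLaw d := by
  have hmeas : Measurable fun p : (ℝ × Bool) × Dynamics d => Function.update p.2 q p.1 := by
    refine measurable_pi_lambda _ fun r => ?_
    rcases eq_or_ne r q with rfl | hr
    · simpa using measurable_fst
    · simp only [Function.update_of_ne hr]
      fun_prop
  refine Measure.eq_infinitePi _ fun s t ht => ?_
  rw [Measure.map_apply hmeas (.pi s.countable_toSet fun i _ => ht i)]
  have hpre : (fun p : (ℝ × Bool) × Dynamics d => Function.update p.2 q p.1) ⁻¹' (Set.pi s t) =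
      (if q ∈ s then t q else Set.univ) ×ˢ (Set.pi (s.erase q) t) := by
    ext p
    simp only [Set.mem_preimage, Set.mem_pi, Set.mem_prod, Finset.coe_erase, Set.mem_sdiff,
      Finset.mem_coe, Set.mem_singleton_iff]
    constructor
    · intro h
      refine ⟨?_, fun i hi => ?_⟩
      · split_ifs with hq
        · simpa using h q hq
        · trivial
      · simpa [hi.2] using h i hi.1
    · rintro ⟨h1, h2⟩ i hi
      rcases eq_or_ne i q with rfl | hiq
      · simpa [hi] using h1
      · simpa [hiq] using h2 i ⟨hi, hiq⟩
  rw [hpre, Measure.prod_prod, dynamicsLaw, Measure.infinitePi_pi _ fun i _ => ht i]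
  by_cases hq : q ∈ s
  · rw [if_pos hq, Finset.mul_prod_erase s (fun i => ringLaw (t i)) hq]
  · rw [if_neg hq, measure_univ, one_mul, Finset.erase_eq_of_notMem hq]

/-- Replace the waiting time and coin of the ring `q`. -/
noncomputable def replaceRing (q : Site d × ℕ) (v : ℝ × Bool) (ω : Config d × Dynamics d) :
    Config d × Dynamics d :=
  (ω.1, Function.update ω.2 q v)

theorem measurable_replaceRing (q : Site d × ℕ) :
    Measurable fun p : (ℝ × Bool) × (Config d × Dynamics d) => replaceRing q p.1 p.2 := by
  refine Measurable.prodMk (by fun_prop) (measurable_pi_lambda _ fun r => ?_)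
  rcases eq_or_ne r q with rfl | hr
  · simpa using measurable_fst
  · simp only [Function.update_of_ne hr]
    fun_prop

variable (μ₀ : Measure (Config d))

instance isProbabilityMeasure_jointLaw [IsProbabilityMeasure μ₀] :
    IsProbabilityMeasure (jointLaw μ₀) := by
  unfold jointLaw
  infer_instance

theorem lintegral_jointLaw_resample (q : Site d × ℕ) {f : Config d × Dynamics d → ℝ≥0∞}
    (hf : Measurable f) :
    ∫⁻ ω, f ω ∂jointLaw μ₀ = ∫⁻ ω, ∫⁻ v, f (replaceRing q v ω) ∂ringLaw ∂jointLaw μ₀ := by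
  have hmeas := measurable_replaceRing (d := d) q
  have hswap : Measurable fun p : (Config d × Dynamics d) × (ℝ × Bool) =>
      f (replaceRing q p.2 p.1) := hf.comp (hmeas.comp measurable_swap)
  have hu : Measurable fun p : (ℝ × Bool) × Dynamics d => Function.update p.2 q p.1 := by
    refine measurable_pi_lambda _ fun r => ?_
    rcases eq_or_ne r q with rfl | hr
    · simpa using measurable_fst
    · simp only [Function.update_of_ne hr]
      fun_prop
  unfold jointLaw
  rw [lintegral_prod _ hf.aemeasurable, lintegral_prod _ hswap.lintegral_prod_right'.aemeasurable]
  refine lintegral_congr fun σ₀ => ?_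
  conv_lhs => rw [← dynamicsLaw_resample q]
  rw [lintegral_map (by fun_prop) hu, lintegral_prod_symm]
  · rfl
  · exact (hf.comp (measurable_prodMk_left.comp hu)).aemeasurable

theorem jointLaw_resample (q : Site d × ℕ) {E : Set (Config d × Dynamics d)}
    (hE : MeasurableSet E) :
    jointLaw μ₀ E = ∫⁻ ω, ringLaw {v | replaceRing q v ω ∈ E} ∂jointLaw μ₀ := by
  rw [← lintegral_indicator_one hE, lintegral_jointLaw_resample μ₀ q (measurable_one.indicator hE)]
  refine lintegral_congr fun ω => ?_
  rw [← lintegral_indicator_one]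
  · rfl
  · exact (measurable_replaceRing q).comp measurable_prodMk_right hE

/-- Lengthen the waiting time of the ring `q` by `c`. -/
noncomputable def delayRing (q : Site d × ℕ) (c : ℝ) (ω : Config d × Dynamics d) :
    Config d × Dynamics d :=
  replaceRing q ((ω.2 q).1 + c, (ω.2 q).2) ω

/-- Turn around the coin of the ring `q`. -/
noncomputable def flipCoin (q : Site d × ℕ) (ω : Config d × Dynamics d) : Config d × Dynamics d :=
  replaceRing q ((ω.2 q).1, !(ω.2 q).2) ω

theorem replaceRing_replaceRing (q : Site d × ℕ) (v w : ℝ × Bool) (ω : Config d × Dynamics d) :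
    replaceRing q v (replaceRing q w ω) = replaceRing q v ω := by
  simp [replaceRing]

theorem replaceRing_apply_self (q : Site d × ℕ) (v : ℝ × Bool) (ω : Config d × Dynamics d) :
    (replaceRing q v ω).2 q = v := by
  simp [replaceRing]

theorem measurable_delayRing (q : Site d × ℕ) (c : ℝ) : Measurable (delayRing (d := d) q c) :=
  (measurable_replaceRing q).comp
    (f := fun ω : Config d × Dynamics d => (((ω.2 q).1 + c, (ω.2 q).2), ω)) (by fun_prop)

theorem measurable_flipCoin (q : Site d × ℕ) : Measurable (flipCoin (d := d) q) :=
  (measurable_replaceRing q).comp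
    (f := fun ω : Config d × Dynamics d => (((ω.2 q).1, !(ω.2 q).2), ω)) <| by
      refine Measurable.prodMk (Measurable.prodMk (by fun_prop) ?_) measurable_id
      exact (measurable_of_finite (fun b : Bool => !b)).comp (by fun_prop)

/-- With the other coordinates frozen by resampling, the delay is a shift of one exponential
variable, so the one-dimensional bound applies on each section. -/
theorem jointLaw_delay_le (q : Site d × ℕ) (c : ℝ) {E : Set (Config d × Dynamics d)}
    (hE : MeasurableSet E) :
    jointLaw μ₀ {ω | 0 < (ω.2 q).1 + c ∧ delayRing q c ω ∈ E} ≤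
      ENNReal.ofReal (Real.exp c) * jointLaw μ₀ E := by
  have hm : MeasurableSet {ω : Config d × Dynamics d |
      0 < (ω.2 q).1 + c ∧ delayRing q c ω ∈ E} :=
    (measurableSet_lt (g := fun ω : Config d × Dynamics d => (ω.2 q).1 + c) measurable_const
      (by fun_prop)).inter (measurable_delayRing q c hE)
  have hsec : ∀ ω, MeasurableSet {v | replaceRing q v ω ∈ E} := fun ω =>
    (measurable_replaceRing q).comp measurable_prodMk_right hE
  rw [jointLaw_resample μ₀ q hm, jointLaw_resample μ₀ q hE, ← lintegral_const_mul']
  · refine lintegral_mono fun ω => ?_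
    simp only [delayRing, Set.mem_ofPred_eq, replaceRing_replaceRing, replaceRing_apply_self]
    exact ringLaw_shift_le c (hsec ω)
  · exact ENNReal.ofReal_ne_top

theorem jointLaw_flipCoin (q : Site d × ℕ) {E : Set (Config d × Dynamics d)}
    (hE : MeasurableSet E) : jointLaw μ₀ (flipCoin q ⁻¹' E) = jointLaw μ₀ E := by
  have hsec : ∀ ω, MeasurableSet {v | replaceRing q v ω ∈ E} := fun ω =>
    (measurable_replaceRing q).comp measurable_prodMk_right hE
  rw [jointLaw_resample μ₀ q (measurable_flipCoin q hE), jointLaw_resample μ₀ q hE]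
  refine lintegral_congr fun ω => ?_
  simp only [flipCoin, Set.mem_preimage, replaceRing_replaceRing, replaceRing_apply_self]
  exact ringLaw_flip (hsec ω)

/-! ### Translation invariance and independence of the sites -/

theorem measurable_translateConfig (a : Site d) : Measurable (translateConfig a) := by
  unfold translateConfig
  fun_prop

theorem measurable_translateDynamics (a : Site d) : Measurable (translateDynamics a) := by
  unfold translateDynamics
  fun_prop

theorem map_translateDynamics (a : Site d) :
    (dynamicsLaw d).map (translateDynamics a) = dynamicsLaw d := by
  have h := Measure.infinitePi_map_piCongrLeft (fun _ : Site d × ℕ => ringLaw)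
    ((Equiv.addRight (-a)).prodCongr (Equiv.refl ℕ))
  have h2 : ⇑(MeasurableEquiv.piCongrLeft (fun _ : Site d × ℕ => ℝ × Bool)
      ((Equiv.addRight (-a)).prodCongr (Equiv.refl ℕ))) = translateDynamics a := by
    funext θ q
    rw [MeasurableEquiv.coe_piCongrLeft, Equiv.piCongrLeft_apply_eq_cast, cast_eq]
    simp [translateDynamics, Prod.map]
  rw [h2] at h
  exact h

/-- Translation of the initial configuration and of the dynamics. -/
def translate (a : Site d) (ω : Config d × Dynamics d) : Config d × Dynamics d :=
  (translateConfig a ω.1, translateDynamics a ω.2)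

theorem measurePreserving_translate [IsProbabilityMeasure μ₀]
    (hμ₀ : IsTranslationInvariant μ₀) (a : Site d) :
    MeasurePreserving (translate a) (jointLaw μ₀) (jointLaw μ₀) :=
  MeasurePreserving.prod ⟨measurable_translateConfig a, hμ₀ a⟩
    ⟨measurable_translateDynamics a, map_translateDynamics a⟩

theorem isTranslationInvariant_symmetricBernoulli :
    IsTranslationInvariant (symmetricBernoulli d) := by
  intro a
  have h := Measure.infinitePi_map_piCongrLeft
    (fun _ : Site d => (PMF.uniformOfFintype ℤˣ).toMeasure) (Equiv.addRight (-a))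
  have h2 : ⇑(MeasurableEquiv.piCongrLeft (fun _ : Site d => ℤˣ) (Equiv.addRight (-a))) =
      fun (σ : Config d) (x : Site d) => σ (x + a) := by
    funext σ x
    rw [MeasurableEquiv.coe_piCongrLeft, Equiv.piCongrLeft_apply_eq_cast, cast_eq]
    simp
  rw [h2] at h
  exact h

/-- The law of the sequence of waiting times and coins at one site. -/
noncomputable def siteLaw : Measure (ℕ → ℝ × Bool) := Measure.infinitePi fun _ => ringLaw

/-- Currying turns the product over sites and ring indices into a product over sites of the law of a
whole clock. -/
theorem dynamicsLaw_forall_mem_finset (s : Finset (Site d)) {A : Set (ℕ → ℝ × Bool)}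
    (hA : MeasurableSet A) :
    dynamicsLaw d {θ | ∀ x ∈ s, (fun n => θ (x, n)) ∈ A} = siteLaw A ^ s.card := by
  have h := Measure.infinitePi_map_curry (fun (_ : Site d) (_ : ℕ) => ringLaw)
  have h1 : MeasurableSet (Set.pi (s : Set (Site d)) fun _ => A) :=
    .pi s.countable_toSet fun _ _ => hA
  have h2 := congrArg (fun m => m (Set.pi (s : Set (Site d)) fun _ => A)) h
  have : IsProbabilityMeasure siteLaw := by unfold siteLaw; infer_instance
  rw [Measure.map_apply (MeasurableEquiv.measurable _) h1,
    Measure.infinitePi_pi _ fun _ _ => hA, Finset.prod_const] at h2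
  exact h2

/-! ### Measurability -/

theorem measurable_apply_nat {α β : Type*} [MeasurableSpace α] [MeasurableSpace β]
    {f : ℕ → α → β} (hf : ∀ n, Measurable (f n)) {N : α → ℕ} (hN : Measurable N) :
    Measurable fun a => f (N a) a := by
  have h : Measurable fun p : ℕ × α => f p.1 p.2 := measurable_from_prod_countable_right hf
  exact h.comp (hN.prodMk measurable_id)

theorem measurable_sInf_nat {α : Type*} [MeasurableSpace α] {P : ℕ → α → Prop}
    (hP : ∀ n, MeasurableSet {a | P n a}) : Measurable fun a => sInf {n | P n a} := by
  classical
  have h1 : MeasurableSet {a | ∃ n, P n a} := by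
    simp only [Set.ofPred_exists]
    exact .iUnion hP
  -- The default `0` matches the convention that the infimum of the empty set of naturals is `0`.
  have h2 : Measurable fun a => if h : ∃ n, P n a then Nat.find h else 0 := by
    refine measurable_to_countable' fun m => ?_
    have : (fun a => if h : ∃ n, P n a then Nat.find h else 0) ⁻¹' {m} =
        ({a | P m a} ∩ ⋂ k ∈ Finset.range m, {a | P k a}ᶜ) ∪
          ({a | ∃ n, P n a}ᶜ ∩ {_a | m = 0}) := by
      ext a
      simp only [Set.mem_preimage, Set.mem_singleton_iff, Set.mem_union, Set.mem_inter_iff,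
        Set.mem_iInter, Set.mem_compl_iff, Set.mem_ofPred_eq, Finset.mem_range]
      by_cases h : ∃ n, P n a
      · simp [h, Nat.find_eq_iff]
      · rw [dif_neg h]
        constructor
        · intro hm
          exact Or.inr ⟨h, hm.symm⟩
        · rintro (h' | h')
          · exact absurd ⟨m, h'.1⟩ h
          · exact h'.2.symm
    rw [this]
    exact ((hP m).inter (Finset.measurableSet_biInter _ fun k _ => (hP k).compl)).union
      (h1.compl.inter (.const _))
  convert h2 using 2 with a
  split_ifs with h
  · exact Nat.sInf_def (s := {n | P n a}) h
  · have : {n | P n a} = ∅ := Set.eq_empty_of_forall_notMem fun n hn => h ⟨n, hn⟩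
    rw [this, Nat.sInf_empty]

@[fun_prop]
theorem measurable_ringTime (x : Site d) (n : ℕ) :
    Measurable fun ω : Config d × Dynamics d => ringTime ω.2 x n := by
  unfold ringTime
  fun_prop

theorem measurable_ringsBefore (x : Site d) {s : Config d × Dynamics d → ℝ} (hs : Measurable s) :
    Measurable fun ω => ringsBefore ω.2 x (s ω) :=
  measurable_sInf_nat fun n => measurableSet_le hs (measurable_ringTime x n)

theorem measurable_ringsUpTo (x : Site d) {s : Config d × Dynamics d → ℝ} (hs : Measurable s) :
    Measurable fun ω => ringsUpTo ω.2 x (s ω) :=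
  measurable_sInf_nat fun n => measurableSet_lt hs (measurable_ringTime x n)

theorem measurable_energyChange (x : Site d) : Measurable fun σ : Config d => energyChange σ x := by
  have h : ∀ y : Site d, Measurable fun σ : Config d => (σ y : ℤ) := fun y =>
    (Measurable.of_discrete (f := fun u : ℤˣ => (u : ℤ))).comp (measurable_pi_apply y)
  unfold energyChange
  exact (Finset.measurable_sum _ fun i _ =>
    ((h _).mul (h _)).add ((h _).mul (h _))).const_mul 2

theorem measurable_updatedSpin (x : Site d) :
    Measurable fun p : Config d × Bool => updatedSpin p.1 x p.2 := by
  have he : Measurable fun p : Config d × Bool => energyChange p.1 x :=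
    (measurable_energyChange x).comp measurable_fst
  unfold updatedSpin
  refine Measurable.ite ?_ ?_ (by fun_prop)
  · exact (he (measurableSet_Iio (a := (0 : ℤ)))).union
      ((he (measurableSet_singleton 0)).inter (measurable_snd (measurableSet_singleton true)))
  · exact (Measurable.of_discrete (f := fun u : ℤˣ => -u)).comp (by fun_prop)

theorem measurable_approxSpin (K : ℕ) :
    ∀ x n, Measurable fun ω : Config d × Dynamics d => approxSpin ω.2 ω.1 K x n := by
  induction K with
  | zero => intro x n; simp only [approxSpin]; fun_prop
  | succ K ih =>
    intro x n
    cases n with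
    | zero => simp only [approxSpin]; fun_prop
    | succ n =>
      simp only [approxSpin]
      refine (measurable_updatedSpin x).comp (f := fun ω : Config d × Dynamics d =>
        ((fun z => approxSpin ω.2 ω.1 K z (ringsBefore ω.2 z (ringTime ω.2 x n))),
          (ω.2 (x, n)).2)) (Measurable.prodMk (measurable_pi_lambda _ fun z => ?_) (by fun_prop))
      exact measurable_apply_nat (ih z) (measurable_ringsBefore z (measurable_ringTime x n))

theorem measurable_spinAfter (x : Site d) (n : ℕ) :
    Measurable fun ω : Config d × Dynamics d => spinAfter ω.2 ω.1 x n := by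
  unfold spinAfter
  refine Measurable.ite ?_ measurable_const measurable_const
  simp only [eventually_atTop]
  have : {ω : Config d × Dynamics d | ∃ K₀, ∀ K ≥ K₀, approxSpin ω.2 ω.1 K x n = 1} =
      ⋃ K₀, ⋂ K ≥ K₀, (fun ω => approxSpin ω.2 ω.1 K x n) ⁻¹' {1} := by
    ext ω
    simp
  rw [this]
  exact .iUnion fun K₀ => .iInter fun K => .iInter fun _ =>
    measurable_approxSpin K x n (measurableSet_singleton 1)

theorem measurable_stateAt {s : Config d × Dynamics d → ℝ} (hs : Measurable s) :
    Measurable fun ω => stateAt ω.2 ω.1 (s ω) :=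
  measurable_pi_lambda _ fun x =>
    measurable_apply_nat (measurable_spinAfter x) (measurable_ringsUpTo x hs)

theorem measurable_stateBefore {s : Config d × Dynamics d → ℝ} (hs : Measurable s) :
    Measurable fun ω => stateBefore ω.2 ω.1 (s ω) :=
  measurable_pi_lambda _ fun x =>
    measurable_apply_nat (measurable_spinAfter x) (measurable_ringsBefore x hs)

/-- This form serves measurability: there are countably many finite sets `S`, their connectedness is
not random, and the remaining condition concerns finitely many spins. -/
theorem mem_cluster_iff_exists_finset {σ : Config d} {z y : Site d} :
    y ∈ cluster σ z ↔ ∃ S : Finset (Site d), (z ∈ S ∧ y ∈ S ∧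
      ((lattice d).induce (S : Set (Site d))).Preconnected) ∧ ∀ v ∈ S, σ v = σ z := by
  classical
  constructor
  · rintro ⟨p⟩
    let f : equalSpinGraph σ →g lattice d := ⟨id, fun h => h.1⟩
    have hsupp : (p.map f).support = p.support := by simp [f]
    refine ⟨p.support.toFinset, ⟨by simp, by simp, ?_⟩, fun v hv => ?_⟩
    · have := (p.map f).connected_induce_support.preconnected
      rw [hsupp] at this
      have hset : ((p.support.toFinset : Finset (Site d)) : Set (Site d)) =
        {v | v ∈ p.support} := by ext; simp
      rw [hset]
      exact this
    · exact spin_eq_of_mem_cluster (p.takeUntil v (by simpa using hv)).reachable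
  · rintro ⟨S, ⟨hz, hy, hS⟩, hσ⟩
    exact (cluster_isGreatest σ z).2 (show (S : Set (Site d)) ∈ _ from
      ⟨hz, hS, fun a ha b hb => (hσ a ha).trans (hσ b hb).symm⟩) hy

theorem measurableSet_mem_cluster (z y : Site d) :
    MeasurableSet {σ : Config d | y ∈ cluster σ z} := by
  simp only [mem_cluster_iff_exists_finset, Set.ofPred_exists]
  have hS (S : Finset (Site d)) : MeasurableSet {σ : Config d | ∀ v ∈ S, σ v = σ z} := by
    have : {σ : Config d | ∀ v ∈ S, σ v = σ z} = ⋂ v ∈ S, {σ | σ v = σ z} := by ext; simp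
    rw [this]
    exact Finset.measurableSet_biInter _ fun v _ => measurableSet_eq_fun (by fun_prop) (by fun_prop)
  exact .iUnion fun S => (MeasurableSet.const _).inter (hS S)

theorem measurableSet_encard_cluster_le (z : Site d) (M : ℕ) :
    MeasurableSet {σ : Config d | (cluster σ z).encard ≤ M} := by
  have : {σ : Config d | (cluster σ z).encard ≤ M} =
      ⋃ F : Finset (Site d), {_σ | F.card ≤ M} ∩ ⋂ y : Site d, {σ | y ∈ cluster σ z → y ∈ F} := by
    ext σ
    simp only [Set.mem_ofPred_eq, Set.mem_iUnion, Set.mem_inter_iff, Set.mem_iInter]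
    constructor
    · intro h
      refine ⟨(cluster_finite h).toFinset, ?_, by simp⟩
      rw [(cluster_finite h).encard_eq_coe_toFinset_card] at h
      exact_mod_cast h
    · rintro ⟨F, hF, hsub⟩
      have h1 : (cluster σ z).encard ≤ (F : Set (Site d)).encard := Set.encard_le_encard hsub
      rw [Set.encard_coe_eq_coe_finsetCard] at h1
      exact h1.trans (by exact_mod_cast hF)
  rw [this]
  refine .iUnion fun F => (MeasurableSet.const _).inter (.iInter fun y => ?_)
  exact (measurableSet_mem_cluster z y).imp (.const _)

/-! ### Almost sure properties of the ring times -/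

theorem ringTime_replaceRing (q : Site d × ℕ) (v : ℝ × Bool) (ω : Config d × Dynamics d)
    (x : Site d) (n : ℕ) :
    ringTime (replaceRing q v ω).2 x n =
      ringTime ω.2 x n + if q.1 = x ∧ q.2 ≤ n then v.1 - (ω.2 q).1 else 0 := by
  obtain ⟨y, m⟩ := q
  induction n with
  | zero =>
    rw [ringTime_zero, ringTime_zero]
    by_cases h : y = x ∧ m ≤ 0
    · obtain ⟨rfl, hm⟩ := h
      obtain rfl : m = 0 := by omega
      simp [replaceRing]
    · rw [if_neg h, add_zero]
      have : (x, 0) ≠ (y, m) := fun hc => h (by simp_all)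
      simp [replaceRing, Function.update_of_ne this]
  | succ n ih =>
    rw [ringTime_succ, ringTime_succ, ih]
    by_cases h : (x, n + 1) = (y, m)
    · obtain ⟨rfl, rfl⟩ := Prod.mk.inj h
      simp [replaceRing]
    · have h2 : (replaceRing (y, m) v ω).2 (x, n + 1) = ω.2 (x, n + 1) := by
        simp [replaceRing, Function.update_of_ne h]
      have h3 : (y = x ∧ m ≤ n + 1) ↔ (y = x ∧ m ≤ n) := by
        constructor
        · rintro ⟨rfl, hm⟩
          refine ⟨rfl, ?_⟩
          rcases Nat.lt_or_ge n m with hc | hc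
          · exact absurd (by rw [show m = n + 1 by omega]) h
          · exact hc
        · rintro ⟨rfl, hm⟩
          exact ⟨rfl, by omega⟩
      rw [h2]
      simp only [h3]
      ring

section

variable (μ₀ : Measure (Config d)) [IsProbabilityMeasure μ₀]

omit [IsProbabilityMeasure μ₀] in
theorem ae_pos : ∀ᵐ ω ∂jointLaw μ₀, ∀ q, 0 < (ω.2 q).1 := by
  rw [ae_all_iff]
  intro q
  have h : MeasurableSet {ω : Config d × Dynamics d | ¬ 0 < (ω.2 q).1} :=
    (measurableSet_lt (g := fun ω : Config d × Dynamics d => (ω.2 q).1) measurable_const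
      (by fun_prop)).compl
  rw [ae_iff, jointLaw_resample μ₀ q h]
  refine (lintegral_congr fun ω => ?_).trans lintegral_zero
  simp only [Set.mem_ofPred_eq, replaceRing_apply_self, not_lt]
  exact (ringLaw_preimage_fst (Set.Iic 0)).trans expMeasure_one_Iic_zero

/-- The Laplace transform at `1` of a waiting time. -/
noncomputable def expLaplace : ℝ≥0∞ := ∫⁻ v, ENNReal.ofReal (Real.exp (-v)) ∂expMeasure 1

theorem expLaplace_lt_one : expLaplace < 1 := by
  have h1 : ∀ᵐ v ∂expMeasure 1, ENNReal.ofReal (Real.exp (-v)) < 1 := by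
    have h0 : ∀ᵐ v ∂expMeasure 1, 0 < v := by
      rw [ae_iff]
      simpa [Set.Iic] using expMeasure_one_Iic_zero
    filter_upwards [h0] with v hv
    rw [← ENNReal.ofReal_one, ENNReal.ofReal_lt_ofReal_iff one_pos]
    exact Real.exp_zero ▸ Real.exp_lt_exp.2 (by linarith)
  have h2 : ∫⁻ _, (1 : ℝ≥0∞) ∂expMeasure 1 = 1 := by simp
  rw [← h2]
  refine lintegral_strict_mono (IsProbabilityMeasure.ne_zero _) (by fun_prop) ?_ h1
  refine ((lintegral_mono_ae (h1.mono fun v hv => hv.le)).trans_lt ?_).ne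
  rw [h2]
  exact ENNReal.one_lt_top

theorem lintegral_ringLaw_exp_neg :
    ∫⁻ v, ENNReal.ofReal (Real.exp (-v.1)) ∂ringLaw = expLaplace := by
  rw [lintegral_prod _ (by fun_prop)]
  simp [expLaplace, ENNReal.mul_inv_cancel two_ne_zero ENNReal.ofNat_ne_top]

theorem lintegral_exp_neg_ringTime (x : Site d) (n : ℕ) :
    ∫⁻ ω, ENNReal.ofReal (Real.exp (-ringTime ω.2 x n)) ∂jointLaw μ₀ = expLaplace ^ (n + 1) := by
  have hmeas : ∀ m, Measurable fun ω : Config d × Dynamics d =>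
      ENNReal.ofReal (Real.exp (-ringTime ω.2 x m)) := fun m => by fun_prop
  induction n with
  | zero =>
    rw [lintegral_jointLaw_resample μ₀ (x, 0) (hmeas 0)]
    simp [ringTime_zero, replaceRing_apply_self, lintegral_ringLaw_exp_neg]
  | succ n ih =>
    rw [lintegral_jointLaw_resample μ₀ (x, n + 1) (hmeas (n + 1)), pow_succ, ← ih,
      ← lintegral_mul_const _ (hmeas n)]
    refine lintegral_congr fun ω => ?_
    rw [← lintegral_ringLaw_exp_neg, ← lintegral_const_mul _ (by fun_prop)]
    refine lintegral_congr fun v => ?_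
    rw [← ENNReal.ofReal_mul (Real.exp_pos _).le, ← Real.exp_add, ringTime_succ,
      replaceRing_apply_self, ringTime_replaceRing, if_neg (by simp)]
    ring_nf

/-- Exponential Chebyshev: the Laplace transform of the time of ring `n` is a power of a number
below one, which gives a geometric bound. It yields both non-accumulation of rings and a finite mean
number of rings up to `t`. -/
theorem tsum_measure_ringTime_le_ne_top (x : Site d) (t : ℝ) :
    ∑' n, jointLaw μ₀ {ω | ringTime ω.2 x n ≤ t} ≠ ∞ := by
  set ε := ENNReal.ofReal (Real.exp (-t)) with hε
  have hε0 : ε ≠ 0 := by simp [hε, Real.exp_pos]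
  have hb : ∀ n, jointLaw μ₀ {ω | ringTime ω.2 x n ≤ t} ≤ ε⁻¹ * expLaplace ^ n := by
    intro n
    have h1 := mul_meas_ge_le_lintegral (μ := jointLaw μ₀) (f := fun ω : Config d × Dynamics d =>
      ENNReal.ofReal (Real.exp (-ringTime ω.2 x n))) (by fun_prop) ε
    rw [lintegral_exp_neg_ringTime] at h1
    have h2 : {ω : Config d × Dynamics d | ringTime ω.2 x n ≤ t} ⊆
        {ω | ε ≤ ENNReal.ofReal (Real.exp (-ringTime ω.2 x n))} := fun ω hω =>
      ENNReal.ofReal_le_ofReal (Real.exp_le_exp.2 (by have : ringTime ω.2 x n ≤ t := hω; linarith))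
    rw [mul_comm, ← div_eq_mul_inv, ENNReal.le_div_iff_mul_le (Or.inl hε0)
      (Or.inl ENNReal.ofReal_ne_top), mul_comm]
    refine (mul_le_mul_right (measure_mono h2) ε).trans (h1.trans ?_)
    exact pow_le_pow_right_of_le_one' expLaplace_lt_one.le (Nat.le_succ n)
  refine ne_top_of_le_ne_top ?_ (ENNReal.tsum_le_tsum hb)
  rw [ENNReal.tsum_mul_left, ENNReal.tsum_geometric]
  refine ENNReal.mul_ne_top (ENNReal.inv_ne_top.2 hε0) (ENNReal.inv_ne_top.2 ?_)
  exact (tsub_pos_of_lt expLaplace_lt_one).ne'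

theorem ae_unbounded : ∀ᵐ ω ∂jointLaw μ₀, ∀ (x : Site d) (t : ℝ), ∃ n, t < ringTime ω.2 x n := by
  have h : ∀ᵐ ω ∂jointLaw μ₀, ∀ (x : Site d) (N : ℕ), ∃ n, (N : ℝ) < ringTime ω.2 x n := by
    simp only [ae_all_iff]
    intro x N
    filter_upwards [ae_eventually_notMem (tsum_measure_ringTime_le_ne_top μ₀ x N)] with ω hω
    obtain ⟨n, hn⟩ := hω.exists
    exact ⟨n, not_le.1 hn⟩
  filter_upwards [h] with ω hω x t
  obtain ⟨N, hN⟩ := exists_nat_gt t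
  obtain ⟨n, hn⟩ := hω x N
  exact ⟨n, hN.trans hn⟩

theorem ae_isRegular : ∀ᵐ ω ∂jointLaw μ₀, IsRegular ω.2 := by
  filter_upwards [ae_pos μ₀, ae_unbounded μ₀] with ω h1 h2 using ⟨h1, h2⟩

omit [IsProbabilityMeasure μ₀] in
-- Given all other coordinates, the ring time is a translate of an atomless variable while `g` is
-- fixed.
theorem ae_ringTime_ne (x : Site d) (n : ℕ) {g : Config d × Dynamics d → ℝ} (hg : Measurable g)
    (hind : ∀ v ω, g (replaceRing (x, n) v ω) = g ω) :
    ∀ᵐ ω ∂jointLaw μ₀, ringTime ω.2 x n ≠ g ω := by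
  have h : MeasurableSet {ω : Config d × Dynamics d | ¬ ringTime ω.2 x n ≠ g ω} :=
    (measurableSet_eq_fun (measurable_ringTime x n) hg).compl.compl
  rw [ae_iff, jointLaw_resample μ₀ (x, n) h]
  refine (lintegral_congr fun ω => ?_).trans lintegral_zero
  simp only [Set.mem_ofPred_eq, hind, ringTime_replaceRing, not_not, le_refl, and_self, if_true]
  refine (congrArg ringLaw ?_).trans ((ringLaw_preimage_fst
    {g ω - ringTime ω.2 x n + (ω.2 (x, n)).1}).trans (measure_singleton _))
  ext v
  simp only [Set.mem_ofPred_eq, Set.mem_preimage, Set.mem_singleton_iff]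
  constructor <;> intro h <;> linarith

omit [IsProbabilityMeasure μ₀] in
theorem ae_no_tie : ∀ᵐ ω ∂jointLaw μ₀, ∀ p q : Site d × ℕ, p.1 ≠ q.1 →
    ringTime ω.2 p.1 p.2 ≠ ringTime ω.2 q.1 q.2 := by
  simp only [ae_all_iff]
  intro p q hpq
  refine ae_ringTime_ne μ₀ p.1 p.2 (measurable_ringTime q.1 q.2) fun v ω => ?_
  rw [ringTime_replaceRing, if_neg (fun h => hpq h.1), add_zero]

theorem measurableSet_exists_ringTime_mem (x : Site d) {U : Set ℝ} (hU : MeasurableSet U) :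
    MeasurableSet {ω : Config d × Dynamics d | ∃ n, ringTime ω.2 x n ∈ U} := by
  simp only [Set.ofPred_exists]
  exact .iUnion fun n => measurable_ringTime x n hU

/-- In a short time interval it is unlikely that the clock at a given site rings. -/
theorem exists_interval_measure_lt (x : Site d) (a : ℝ) {ε : ℝ≥0∞} (hε : 0 < ε) :
    ∃ δ > 0, jointLaw μ₀ {ω | ∃ n, ringTime ω.2 x n ∈ Set.Ioo (a - δ) (a + δ)} < ε := by
  set R : ℕ → Set (Config d × Dynamics d) := fun m =>
    {ω | ∃ n, ringTime ω.2 x n ∈ Set.Ioo (a - 1 / ((m : ℝ) + 1)) (a + 1 / ((m : ℝ) + 1))} with hR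
  have hmeas : ∀ m, NullMeasurableSet (R m) (jointLaw μ₀) := fun m =>
    (measurableSet_exists_ringTime_mem x measurableSet_Ioo).nullMeasurableSet
  have hanti : Antitone R := by
    rintro m m' hm ω ⟨n, h1, h2⟩
    have := Nat.one_div_le_one_div (α := ℝ) hm
    exact ⟨n, by linarith, by linarith⟩
  have hlim := tendsto_measure_iInter_atTop hmeas hanti ⟨0, measure_ne_top _ _⟩
  -- Almost surely no ring occurs exactly at `a`, and only finitely many occur up to `a + 1`, so the
  -- rings keep a positive distance from `a`.
  have hnull : jointLaw μ₀ (⋂ m, R m) = 0 := by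
    have hne : ∀ᵐ ω ∂jointLaw μ₀, ∀ n, ringTime ω.2 x n ≠ a :=
      ae_all_iff.2 fun n => ae_ringTime_ne μ₀ x n measurable_const fun _ _ => rfl
    refine measure_mono_null (fun ω hω => ?_)
      (ae_iff.1 ((ae_isRegular μ₀).and hne))
    rintro ⟨hreg, hω2⟩
    have hfin := hreg.finite_setOf_ringTime_le x (a + 1)
    have hpos : ∃ m : ℕ, ∀ n ∈ {n | ringTime ω.2 x n ≤ a + 1},
        1 / ((m : ℝ) + 1) < |ringTime ω.2 x n - a| := by
      have : ∀ᶠ m : ℕ in atTop, ∀ n ∈ {n | ringTime ω.2 x n ≤ a + 1},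
          1 / ((m : ℝ) + 1) < |ringTime ω.2 x n - a| := by
        rw [eventually_all_finite hfin]
        intro n _
        exact tendsto_one_div_add_atTop_nhds_zero_nat.eventually
          (gt_mem_nhds (abs_pos.2 (sub_ne_zero.2 (hω2 n))))
      exact this.exists
    obtain ⟨m, hm⟩ := hpos
    obtain ⟨n, h1, h2⟩ := Set.mem_iInter.1 hω m
    have hle : 1 / ((m : ℝ) + 1) ≤ 1 := by
      rw [div_le_one (by positivity)]
      linarith [(Nat.cast_nonneg m : (0 : ℝ) ≤ m)]
    have h3 := hm n (by change ringTime ω.2 x n ≤ a + 1; linarith)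
    have h4 : |ringTime ω.2 x n - a| < 1 / ((m : ℝ) + 1) := abs_lt.2 ⟨by linarith, by linarith⟩
    linarith
  rw [hnull] at hlim
  obtain ⟨m, hm⟩ := (hlim.eventually (gt_mem_nhds hε)).exists
  exact ⟨1 / ((m : ℝ) + 1), by positivity, hm⟩

/-- The events that the clocks at given sites ring in a given set of times are independent and
equally likely. -/
theorem measure_forall_exists_ringTime_mem (s : Finset (Site d)) {U : Set ℝ}
    (hU : MeasurableSet U) :
    jointLaw μ₀ {ω | ∀ x ∈ s, ∃ n, ringTime ω.2 x n ∈ U} =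
      jointLaw μ₀ {ω | ∃ n, ringTime ω.2 0 n ∈ U} ^ s.card := by
  set A : Set (ℕ → ℝ × Bool) := {w | ∃ n, ∑ k ∈ Finset.range (n + 1), (w k).1 ∈ U} with hA
  have hAm : MeasurableSet A := by
    simp only [hA, Set.ofPred_exists]
    exact .iUnion fun n => (show Measurable fun w : ℕ → ℝ × Bool =>
      ∑ k ∈ Finset.range (n + 1), (w k).1 by fun_prop) hU
  have key : ∀ s : Finset (Site d), jointLaw μ₀ {ω | ∀ x ∈ s, ∃ n, ringTime ω.2 x n ∈ U} =
      siteLaw A ^ s.card := by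
    intro s
    rw [← dynamicsLaw_forall_mem_finset s hAm]
    have hms : MeasurableSet {θ : Dynamics d | ∀ x ∈ s, (fun n => θ (x, n)) ∈ A} := by
      have : {θ : Dynamics d | ∀ x ∈ s, (fun n => θ (x, n)) ∈ A} =
          ⋂ x ∈ s, (fun θ : Dynamics d => fun n => θ (x, n)) ⁻¹' A := by ext; simp
      rw [this]
      exact Finset.measurableSet_biInter _ fun x _ => (by fun_prop :
        Measurable (fun θ : Dynamics d => fun n => θ (x, n))) hAm
    exact (measurePreserving_snd (μ := μ₀) (ν := dynamicsLaw d)).measure_preimage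
      hms.nullMeasurableSet
  have h0 := key {0}
  simp only [Finset.mem_singleton, forall_eq, Finset.card_singleton, pow_one] at h0
  rw [key, h0]

/-! ### Influences propagate at finite speed -/

/-- The unit step in direction `s.1`, backwards if `s.2` holds. -/
def unitStep (s : Fin d × Bool) : Site d := if s.2 then -Pi.single s.1 1 else Pi.single s.1 1

theorem exists_unitStep {x y : Site d} (h : (lattice d).Adj x y) : ∃ s, y = x + unitStep s := by
  obtain ⟨i, rfl | rfl⟩ := (lattice_adj_iff _ _).1 h
  · exact ⟨(i, false), by simp [unitStep]⟩
  · exact ⟨(i, true), by simp [unitStep, sub_eq_add_neg]⟩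

/-- There is a self-avoiding lattice path with `L` steps from `x` through sites of `A`. -/
def HasPath (A : Set (Site d)) (x : Site d) (L : ℕ) : Prop :=
  ∃ f : ℕ → Site d, f 0 = x ∧ (∀ i < L, (lattice d).Adj (f i) (f (i + 1))) ∧
    Set.InjOn f (Set.Iic L) ∧ ∀ i ≤ L, f i ∈ A

/-- The sites at which some clock ring occurs at a time in `U`. -/
def ringingSites (U : Set ℝ) (θ : Dynamics d) : Set (Site d) := {x | ∃ n, ringTime θ x n ∈ U}

/-- Path counting: there are `(2d)^L` sequences of steps, and a self-avoiding one passes through `L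
+ 1` distinct sites whose clocks are independent. -/
theorem measure_hasPath_le (x : Site d) (L : ℕ) {U : Set ℝ} (hU : MeasurableSet U) :
    jointLaw μ₀ {ω | HasPath (ringingSites U ω.2) x L} ≤
      (d * 2 : ℕ) ^ L * jointLaw μ₀ {ω | ∃ n, ringTime ω.2 0 n ∈ U} ^ (L + 1) := by
  classical
  set pos : (Fin L → Fin d × Bool) → ℕ → Site d := fun s i =>
    x + ∑ j ∈ Finset.range i, if h : j < L then unitStep (s ⟨j, h⟩) else 0 with hpos
  set E : (Fin L → Fin d × Bool) → Set (Config d × Dynamics d) := fun s =>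
    {ω | Set.InjOn (pos s) (Set.Iic L) ∧ ∀ i ≤ L, pos s i ∈ ringingSites U ω.2} with hE
  have hsub : {ω | HasPath (ringingSites U ω.2) x L} ⊆ ⋃ s, E s := by
    rintro ω ⟨f, h0, hadj, hinj, hA⟩
    have hst : ∀ i : Fin L, ∃ s, f (i + 1) = f i + unitStep s := fun i =>
      exists_unitStep (hadj i i.2)
    choose s hs using hst
    have hf : ∀ i ≤ L, f i = pos s i := by
      intro i
      induction i with
      | zero => intro _; simp [hpos, h0]
      | succ i ih =>
        intro hi
        rw [hs ⟨i, hi⟩, ih (by omega)]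
        simp only [hpos]
        rw [Finset.sum_range_succ, dif_pos (show i < L from hi), add_assoc]
    refine Set.mem_iUnion.2 ⟨s, ?_, fun i hi => hf i hi ▸ hA i hi⟩
    exact hinj.congr fun i hi => hf i hi
  have hEs : ∀ s, jointLaw μ₀ (E s) ≤
      jointLaw μ₀ {ω | ∃ n, ringTime ω.2 0 n ∈ U} ^ (L + 1) := by
    intro s
    by_cases hinj : Set.InjOn (pos s) (Set.Iic L)
    · have hcard : ((Finset.range (L + 1)).image (pos s)).card = L + 1 := by
        rw [Finset.card_image_of_injOn, Finset.card_range]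
        exact hinj.mono fun i hi => by simpa [Nat.lt_succ_iff] using hi
      rw [← hcard, ← measure_forall_exists_ringTime_mem μ₀ _ hU]
      refine measure_mono fun ω hω y hy => ?_
      obtain ⟨i, hi, rfl⟩ := Finset.mem_image.1 hy
      exact hω.2 i (Nat.lt_succ_iff.1 (Finset.mem_range.1 hi))
    · have : E s = ∅ := Set.eq_empty_of_forall_notMem fun ω hω => hinj hω.1
      rw [this, measure_empty]
      exact zero_le
  refine (measure_mono hsub).trans ((measure_iUnion_le _).trans
    ((ENNReal.tsum_le_tsum hEs).trans ?_))
  rw [tsum_fintype, Finset.sum_const, Finset.card_univ, Fintype.card_fun, Fintype.card_fin,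
    Fintype.card_prod, Fintype.card_fin, Fintype.card_bool, nsmul_eq_mul]
  push_cast
  exact le_rfl

/-- Around every time there is an interval such that the sites with a ring in this interval form
finite connected components. -/
theorem exists_interval_ae_not_hasPath (hd : 1 ≤ d) (a : ℝ) :
    ∃ δ > 0, ∀ᵐ ω ∂jointLaw μ₀, ∀ x, ∃ L,
      ¬ HasPath (ringingSites (Set.Ioo (a - δ) (a + δ)) ω.2) x L := by
  have hd0 : ((d * 2 : ℕ) : ℝ≥0∞) ≠ 0 := by simp; omega
  -- The threshold `1/(4d)` makes `2d` times the probability of a ring less than one half, so long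
  -- paths have geometrically small probability.
  obtain ⟨δ, hδ, hlt⟩ := exists_interval_measure_lt μ₀ (0 : Site d) a
    (ε := ((d * 2 : ℕ) : ℝ≥0∞)⁻¹ * 2⁻¹)
    (ENNReal.mul_pos (ENNReal.inv_ne_zero.2 (ENNReal.natCast_ne_top _)) (by simp))
  refine ⟨δ, hδ, ae_all_iff.2 fun x => ?_⟩
  have hle : ∀ L, jointLaw μ₀ {ω | ¬ ∃ L,
      ¬ HasPath (ringingSites (Set.Ioo (a - δ) (a + δ)) ω.2) x L} ≤ 2⁻¹ ^ L := by
    intro L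
    refine (measure_mono ?_).trans ((measure_hasPath_le μ₀ x L
      (measurableSet_Ioo (a := a - δ) (b := a + δ))).trans ?_)
    · intro ω hω
      by_contra hc
      exact hω ⟨L, hc⟩
    · set p := jointLaw μ₀ {ω : Config d × Dynamics d |
        ∃ n, ringTime ω.2 0 n ∈ Set.Ioo (a - δ) (a + δ)}
      calc ((d * 2 : ℕ) : ℝ≥0∞) ^ L * p ^ (L + 1)
          ≤ ((d * 2 : ℕ) : ℝ≥0∞) ^ L * p ^ L :=
            mul_le_mul_right (pow_le_pow_right_of_le_one' prob_le_one (Nat.le_succ L)) _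
        _ = (((d * 2 : ℕ) : ℝ≥0∞) * p) ^ L := (mul_pow _ _ _).symm
        _ ≤ 2⁻¹ ^ L := by
          refine pow_le_pow_left' ((mul_le_mul_right hlt.le _).trans_eq ?_) L
          rw [← mul_assoc, ENNReal.mul_inv_cancel hd0 (ENNReal.natCast_ne_top _), one_mul]
  rw [ae_iff]
  exact le_antisymm (ge_of_tendsto'
    (ENNReal.tendsto_pow_atTop_nhds_zero_of_lt_one (r := 2⁻¹) (by simp)) hle) zero_le

omit [IsProbabilityMeasure μ₀] in
-- The chain may pause or revisit sites, but its endpoints are joined by a self-avoiding path in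
-- `A`; if that had `L` or more steps, its initial segment would be a forbidden path.
theorem mem_box_of_chain {A : Set (Site d)} {x : Site d} {L : ℕ} (hL : ¬ HasPath A x L)
    {f : ℕ → Site d} (h0 : f 0 = x) (hA : ∀ i, f i ∈ A) (hf : ∀ i, f (i + 1) ∈ star (f i)) :
    ∀ i, f i ∈ box x L := by
  classical
  let G : SimpleGraph (Site d) :=
    { Adj := fun y z => (lattice d).Adj y z ∧ y ∈ A ∧ z ∈ A
      symm := ⟨fun _ _ h => ⟨h.1.symm, h.2.2, h.2.1⟩⟩
      loopless := ⟨fun _ h => h.1.ne rfl⟩ }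
  have hreach : ∀ i, G.Reachable x (f i) := by
    intro i
    induction i with
    | zero => rw [h0]
    | succ i ih =>
      rcases mem_star.1 (hf i) with h | h
      · rwa [h]
      · exact ih.trans (SimpleGraph.Adj.reachable (G := G) ⟨h, hA i, hA (i + 1)⟩)
  intro i
  obtain ⟨p, hp⟩ := (hreach i).exists_isPath
  have hlen : p.length < L := by
    by_contra! hc
    refine hL ⟨p.getVert, p.getVert_zero, fun j hj => ?_, ?_, fun j hj => ?_⟩
    · exact (p.adj_getVert_succ (hj.trans_le hc)).1
    · exact hp.getVert_injOn.mono fun j hj => (show j ≤ L from hj).trans hc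
    · rcases Nat.eq_zero_or_pos j with rfl | hj0
      · rw [p.getVert_zero, ← h0]
        exact hA 0
      · obtain ⟨k, rfl⟩ : ∃ k, j = k + 1 := ⟨j - 1, by omega⟩
        exact (p.adj_getVert_succ (show k < p.length by omega)).2.2
  rw [mem_box]
  intro k
  have := abs_sub_le_length (G := G) (fun _ _ h => h.1) p k
  have h2 : (p.length : ℤ) ≤ L := by exact_mod_cast hlen.le
  exact this.trans h2

/-- Regular realizations without ties in which no ring is influenced by infinitely many others. -/
structure IsGood (θ : Dynamics d) : Prop extends IsRegular θ where
  noTie : ∀ p q : Site d × ℕ, p.1 ≠ q.1 → ringTime θ p.1 p.2 ≠ ringTime θ q.1 q.2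
  wellFounded : WellFounded (Precedes θ)

/-- An infinite descending chain of rings has decreasing positive times, which converge. From some
point on all of them lie in one short interval, so the chain is confined to a box; but the box has
only finitely many rings up to that time, and the rings of the chain are distinct. -/
theorem ae_isGood (hd : 1 ≤ d) : ∀ᵐ ω ∂jointLaw μ₀, IsGood ω.2 := by
  choose δ hδ hpath using exists_interval_ae_not_hasPath μ₀ hd
  -- The exceptional null set depends on the centre of the interval, so only countably many
  -- intervals may be used.
  obtain ⟨S, hS, hcover⟩ := TopologicalSpace.countable_cover_nhds
    (f := fun a : ℝ => Set.Ioo (a - δ a) (a + δ a)) fun a =>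
      Ioo_mem_nhds (by linarith [hδ a]) (by linarith [hδ a])
  have hall := (ae_ball_iff hS).2 fun a (_ : a ∈ S) => hpath a
  filter_upwards [ae_isRegular μ₀, ae_no_tie μ₀, hall] with ω hreg hnt hω
  refine ⟨hreg, hnt, ?_⟩
  rw [wellFounded_iff_isEmpty_descending_chain]
  refine ⟨fun ⟨p, hp⟩ => ?_⟩
  set T : ℕ → ℝ := fun i => ringTime ω.2 (p i).1 (p i).2 with hT
  have hanti : StrictAnti T := strictAnti_nat_of_succ_lt fun i => (hp i).2
  have hlim := tendsto_atTop_ciInf hanti.antitone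
    ⟨0, by rintro _ ⟨i, rfl⟩; exact (hreg.ringTime_pos _ _).le⟩
  obtain ⟨a, ha, hmem⟩ : ∃ a ∈ S, (⨅ i, T i) ∈ Set.Ioo (a - δ a) (a + δ a) := by
    have : (⨅ i, T i) ∈ ⋃ x ∈ S, Set.Ioo (x - δ x) (x + δ x) := by rw [hcover]; trivial
    simpa only [Set.mem_iUnion, exists_prop] using this
  obtain ⟨i₀, hi₀⟩ := eventually_atTop.1 (hlim.eventually (Ioo_mem_nhds hmem.1 hmem.2))
  obtain ⟨L, hL⟩ := hω a ha (p i₀).1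
  have hbox := mem_box_of_chain hL (f := fun i => (p (i₀ + i)).1) rfl
    (fun i => ⟨_, hi₀ (i₀ + i) (by omega)⟩) (fun i => (hp (i₀ + i)).1)
  have hfin : (⋃ x ∈ box (p i₀).1 L, Prod.mk x '' {n | ringTime ω.2 x n ≤ T i₀}).Finite :=
    Set.Finite.biUnion (Finset.finite_toSet _) fun x _ =>
      (hreg.finite_setOf_ringTime_le x _).image _
  have hinj : Function.Injective fun i => p (i₀ + i) := fun i j hij => by
    have : T (i₀ + i) = T (i₀ + j) := by simp only [hT]; rw [show p (i₀ + i) = p (i₀ + j) from hij]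
    have := hanti.injective this
    omega
  refine Set.infinite_range_of_injective hinj (hfin.subset ?_)
  rintro _ ⟨i, rfl⟩
  simp only [Set.mem_iUnion]
  exact ⟨_, hbox i, (p (i₀ + i)).2, hanti.antitone (Nat.le_add_right i₀ i), rfl⟩

end

/-! ### The energy -/

/-- The product rule for two interleaved jump sequences. Expanding `b (N n)` and `a (N' l)` into
their jumps, each pair of jumps is counted in exactly one of the two sums, according to which jump
came first; this is what `h` encodes. -/
theorem sum_range_sub_mul_add {a b : ℕ → ℤ} {m k : ℕ} {N N' : ℕ → ℕ} (hN : ∀ n < m, N n ≤ k)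
    (hN' : ∀ l < k, N' l ≤ m) (h : ∀ n < m, ∀ l < k, (l < N n ↔ ¬ n < N' l)) :
    ∑ n ∈ Finset.range m, (a (n + 1) - a n) * b (N n) +
      ∑ l ∈ Finset.range k, (b (l + 1) - b l) * a (N' l) = a m * b k - a 0 * b 0 := by
  have expand : ∀ (c : ℕ → ℤ) (M r : ℕ), r ≤ M →
      c r = c 0 + ∑ l ∈ Finset.range M, if l < r then c (l + 1) - c l else 0 := by
    intro c M r hr
    rw [← Finset.sum_filter, show (Finset.range M).filter (· < r) = Finset.range r by
      ext l; simp; omega, Finset.sum_range_sub]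
    ring
  have h1 : ∑ n ∈ Finset.range m, (a (n + 1) - a n) * b (N n) =
      (a m - a 0) * b 0 + ∑ n ∈ Finset.range m, ∑ l ∈ Finset.range k,
        if l < N n then (a (n + 1) - a n) * (b (l + 1) - b l) else 0 := by
    rw [← Finset.sum_range_sub a m, Finset.sum_mul, ← Finset.sum_add_distrib]
    refine Finset.sum_congr rfl fun n hn => ?_
    rw [expand b k (N n) (hN n (Finset.mem_range.1 hn)), mul_add, Finset.mul_sum]
    simp only [mul_ite, mul_zero]
  have h2 : ∑ l ∈ Finset.range k, (b (l + 1) - b l) * a (N' l) =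
      (b k - b 0) * a 0 + ∑ n ∈ Finset.range m, ∑ l ∈ Finset.range k,
        if n < N' l then (a (n + 1) - a n) * (b (l + 1) - b l) else 0 := by
    rw [Finset.sum_comm, ← Finset.sum_range_sub b k, Finset.sum_mul, ← Finset.sum_add_distrib]
    refine Finset.sum_congr rfl fun l hl => ?_
    rw [expand a m (N' l) (hN' l (Finset.mem_range.1 hl)), mul_add, Finset.mul_sum]
    simp only [mul_ite, mul_zero]
    refine congrArg _ (Finset.sum_congr rfl fun n _ => ?_)
    rw [mul_comm]
  have h3 : (∑ n ∈ Finset.range m, ∑ l ∈ Finset.range k,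
        if l < N n then (a (n + 1) - a n) * (b (l + 1) - b l) else 0) +
      (∑ n ∈ Finset.range m, ∑ l ∈ Finset.range k,
        if n < N' l then (a (n + 1) - a n) * (b (l + 1) - b l) else 0) =
      (a m - a 0) * (b k - b 0) := by
    rw [← Finset.sum_range_sub a m, ← Finset.sum_range_sub b k, Finset.sum_mul_sum,
      ← Finset.sum_add_distrib]
    refine Finset.sum_congr rfl fun n hn => ?_
    rw [← Finset.sum_add_distrib]
    refine Finset.sum_congr rfl fun l hl => ?_
    have := h n (Finset.mem_range.1 hn) l (Finset.mem_range.1 hl)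
    by_cases hc : n < N' l
    · rw [if_neg (fun h' => this.1 h' hc), if_pos hc, zero_add]
    · rw [if_pos (this.2 hc), if_neg hc, add_zero]
  rw [h1, h2]
  linear_combination h3

/-- The change of the product of the spins at `x` and `y` caused by the ring `n` at `x`. -/
noncomputable def bondJump (x y : Site d) (n : ℕ) (ω : Config d × Dynamics d) : ℤ :=
  ((spinAfter ω.2 ω.1 x (n + 1) : ℤ) - (spinAfter ω.2 ω.1 x n : ℤ)) *
    (stateBefore ω.2 ω.1 (ringTime ω.2 x n) y : ℤ)

/-- The change of the product of the spins at `x` and `y` caused by the rings at `x` up to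
time `t`. -/
noncomputable def bondChange (x y : Site d) (t : ℝ) (ω : Config d × Dynamics d) : ℤ :=
  ∑ n ∈ Finset.range (ringsUpTo ω.2 x t), bondJump x y n ω

/-- Without ties the two endpoints never flip simultaneously, so attributing every change of the
product to one endpoint loses nothing. -/
theorem bondChange_add_bondChange {ω : Config d × Dynamics d} (h : IsGood ω.2) {x y : Site d}
    (hxy : x ≠ y) (t : ℝ) : bondChange x y t ω + bondChange y x t ω =
      (stateAt ω.2 ω.1 t x : ℤ) * (stateAt ω.2 ω.1 t y : ℤ) - (ω.1 x : ℤ) * (ω.1 y : ℤ) := by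
  have hle : ∀ (x y : Site d), ∀ n < ringsUpTo ω.2 x t,
      ringsBefore ω.2 y (ringTime ω.2 x n) ≤ ringsUpTo ω.2 y t := by
    intro x y n hn
    refine Nat.le_of_not_lt fun hc => ?_
    have h1 := h.lt_ringsBefore.1 hc
    have h2 := h.lt_ringTime_ringsUpTo y t
    have h3 := h.lt_ringsUpTo.1 hn
    linarith
  have key := sum_range_sub_mul_add (a := fun n => (spinAfter ω.2 ω.1 x n : ℤ))
    (b := fun n => (spinAfter ω.2 ω.1 y n : ℤ))
    (N := fun n => ringsBefore ω.2 y (ringTime ω.2 x n))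
    (N' := fun n => ringsBefore ω.2 x (ringTime ω.2 y n)) (hle x y) (hle y x)
    (fun n _ l _ => by
      rw [h.lt_ringsBefore, h.lt_ringsBefore, not_lt]
      exact ⟨le_of_lt, fun hc => lt_of_le_of_ne hc (h.noTie (y, l) (x, n) hxy.symm)⟩)
  simp only [spinAfter_zero] at key
  exact key

theorem bondChange_translate (a x y : Site d) (t : ℝ) (ω : Config d × Dynamics d) :
    bondChange x y t (translate a ω) = bondChange (x + a) (y + a) t ω := by
  simp only [bondChange, bondJump, translate, stateBefore, spinAfter_translate]
  rfl

theorem measurable_bondChange (x y : Site d) (t : ℝ) : Measurable (bondChange x y t) := by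
  have hc : Measurable fun u : ℤˣ => (u : ℤ) := Measurable.of_discrete
  refine measurable_apply_nat (f := fun m ω => ∑ n ∈ Finset.range m, bondJump x y n ω)
    (fun m => Finset.measurable_sum _ fun n _ => ?_) (measurable_ringsUpTo x measurable_const)
  exact ((hc.comp (measurable_spinAfter x (n + 1))).sub (hc.comp (measurable_spinAfter x n))).mul
    (hc.comp ((measurable_pi_apply y).comp (measurable_stateBefore (measurable_ringTime x n))))

theorem abs_spin (u : ℤˣ) : |(u : ℤ)| = 1 := by
  rcases Int.units_eq_one_or u with rfl | rfl <;> simp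

theorem abs_bondChange_le (x y : Site d) (t : ℝ) (ω : Config d × Dynamics d) :
    |bondChange x y t ω| ≤ 2 * ringsUpTo ω.2 x t := by
  have hb : ∀ n, |bondJump x y n ω| ≤ 2 := by
    intro n
    rw [bondJump, abs_mul, abs_spin, mul_one]
    refine (abs_sub _ _).trans ?_
    rw [abs_spin, abs_spin]
    norm_num
  refine (Finset.abs_sum_le_sum_abs _ _).trans ((Finset.sum_le_sum fun n _ => hb n).trans ?_)
  simp [mul_comm]

/-- The ring `n` at `x` lowers the energy. -/
def lowering (x : Site d) (n : ℕ) : Set (Config d × Dynamics d) :=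
  {ω | energyChange (stateBefore ω.2 ω.1 (ringTime ω.2 x n)) x < 0}

theorem measurableSet_lowering (x : Site d) (n : ℕ) : MeasurableSet (lowering x n) :=
  ((measurable_energyChange x).comp (measurable_stateBefore (measurable_ringTime x n)))
    (measurableSet_Iio (a := (0 : ℤ)))

/-- The total change of the bonds at `x` caused by the rings at `x` up to time `t`. -/
noncomputable def siteChange (x : Site d) (t : ℝ) (ω : Config d × Dynamics d) : ℤ :=
  ∑ i, (bondChange x (x + Pi.single i 1) t ω + bondChange x (x - Pi.single i 1) t ω)

-- A flip adds minus the energy change to the sum of the bond products at `x`, and a ring without a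
-- flip adds nothing. Hence no ring contributes negatively, and a lowering ring contributes at least
-- one by integrality.
open Classical in
theorem card_lowering_le_siteChange {ω : Config d × Dynamics d} (h : IsGood ω.2) (x : Site d)
    (t : ℝ) : ∑ n ∈ Finset.range (ringsUpTo ω.2 x t), (if ω ∈ lowering x n then (1 : ℤ) else 0) ≤
      siteChange x t ω := by
  simp only [siteChange, bondChange]
  simp_rw [← Finset.sum_add_distrib]
  rw [Finset.sum_comm]
  refine Finset.sum_le_sum fun n _ => ?_
  set τ := stateBefore ω.2 ω.1 (ringTime ω.2 x n) with hτ
  have h1 : spinAfter ω.2 ω.1 x (n + 1) = updatedSpin τ x (ω.2 (x, n)).2 :=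
    spinAfter_succ h.toIsRegular h.wellFounded ω.1 x n
  have h2 : spinAfter ω.2 ω.1 x n = τ x := by
    simp only [hτ, stateBefore, h.ringsBefore_ringTime]
  have hlow : ω ∈ lowering x n ↔ energyChange τ x < 0 := Iff.rfl
  have hsum : ∑ i, (bondJump x (x + Pi.single i 1) n ω + bondJump x (x - Pi.single i 1) n ω) =
      ((updatedSpin τ x (ω.2 (x, n)).2 : ℤ) - (τ x : ℤ)) *
        ∑ i, ((τ (x + Pi.single i 1) : ℤ) + (τ (x - Pi.single i 1) : ℤ)) := by
    rw [Finset.mul_sum]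
    refine Finset.sum_congr rfl fun i _ => ?_
    simp only [bondJump, h1, h2, ← hτ]
    ring
  have henergy : energyChange τ x =
      2 * (τ x : ℤ) * ∑ i, ((τ (x + Pi.single i 1) : ℤ) + (τ (x - Pi.single i 1) : ℤ)) := by
    rw [energyChange, Finset.mul_sum, Finset.mul_sum]
    refine Finset.sum_congr rfl fun i _ => ?_
    ring
  rw [hsum]
  simp only [hlow, updatedSpin]
  split_ifs with h3 h4 h4
  · push_cast
    linarith
  · omega
  · rw [Units.val_neg]
    linarith [h4.resolve_left h3]
  · simp

section

variable (μ₀ : Measure (Config d)) [IsProbabilityMeasure μ₀]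

theorem lintegral_ringsUpTo_ne_top (x : Site d) (t : ℝ) :
    ∫⁻ ω, (ringsUpTo ω.2 x t : ℝ≥0∞) ∂jointLaw μ₀ ≠ ∞ := by
  have hm : ∀ n, MeasurableSet {ω : Config d × Dynamics d | ringTime ω.2 x n ≤ t} := fun n =>
    measurableSet_le (measurable_ringTime x n) measurable_const
  refine ne_top_of_le_ne_top (tsum_measure_ringTime_le_ne_top μ₀ x t) ?_
  calc ∫⁻ ω, (ringsUpTo ω.2 x t : ℝ≥0∞) ∂jointLaw μ₀
      ≤ ∫⁻ ω, ∑' n, {ω : Config d × Dynamics d | ringTime ω.2 x n ≤ t}.indicator 1 ω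
          ∂jointLaw μ₀ := by
        refine lintegral_mono_ae ?_
        filter_upwards [ae_isRegular μ₀] with ω hω
        refine le_trans ?_ (ENNReal.sum_le_tsum (Finset.range (ringsUpTo ω.2 x t)))
        rw [Finset.sum_congr rfl (g := fun _ => (1 : ℝ≥0∞))]
        · simp
        · intro n hn
          have : ringTime ω.2 x n ≤ t := hω.lt_ringsUpTo.1 (Finset.mem_range.1 hn)
          simp [this]
    _ = ∑' n, jointLaw μ₀ {ω | ringTime ω.2 x n ≤ t} := by
        rw [lintegral_tsum fun n => (measurable_one.indicator (hm n)).aemeasurable]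
        exact tsum_congr fun n => lintegral_indicator_one (hm n)

theorem integrable_bondChange (x y : Site d) (t : ℝ) :
    Integrable (fun ω => (bondChange x y t ω : ℝ)) (jointLaw μ₀) := by
  have hc : Measurable fun k : ℤ => (k : ℝ) := Measurable.of_discrete
  refine ⟨(hc.comp (measurable_bondChange x y t)).aestronglyMeasurable, ?_⟩
  refine lt_of_le_of_lt (b := ∫⁻ ω, 2 * (ringsUpTo ω.2 x t : ℝ≥0∞) ∂jointLaw μ₀)
    (lintegral_mono fun ω => ?_) ?_
  · have h1 : ‖(bondChange x y t ω : ℝ)‖ ≤ ((2 * ringsUpTo ω.2 x t : ℕ) : ℝ) := by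
      rw [Real.norm_eq_abs]
      exact_mod_cast abs_bondChange_le x y t ω
    rw [← ofReal_norm]
    refine (ENNReal.ofReal_le_ofReal h1).trans ?_
    rw [ENNReal.ofReal_natCast]
    push_cast
    exact le_rfl
  · rw [lintegral_const_mul' _ _ (by simp)]
    exact ENNReal.mul_lt_top (by simp) (lintegral_ringsUpTo_ne_top μ₀ x t).lt_top

theorem integral_bondChange_translate (hμ₀ : IsTranslationInvariant μ₀) (a x y : Site d) (t : ℝ) :
    ∫ ω, (bondChange (x + a) (y + a) t ω : ℝ) ∂jointLaw μ₀ =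
      ∫ ω, (bondChange x y t ω : ℝ) ∂jointLaw μ₀ := by
  have hmp := measurePreserving_translate μ₀ hμ₀ a
  have hc : Measurable fun k : ℤ => (k : ℝ) := Measurable.of_discrete
  conv_rhs => rw [← hmp.map_eq]
  rw [integral_map (f := fun ω => (bondChange x y t ω : ℝ)) hmp.measurable.aemeasurable
    (hc.comp (measurable_bondChange x y t)).aestronglyMeasurable]
  simp only [bondChange_translate]

/-- Mass transport: in each direction, the part of the backward bond charged to `x` has the same
mean as the part of the forward bond charged to its other endpoint. The two charges then add up to
the change of a single product of spins, which is at most 2. -/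
theorem integral_siteChange_le (hd : 1 ≤ d) (hμ₀ : IsTranslationInvariant μ₀) (x : Site d)
    (t : ℝ) : ∫ ω, (siteChange x t ω : ℝ) ∂jointLaw μ₀ ≤ 2 * d := by
  have hint := fun y => integrable_bondChange μ₀ x y t
  have h1 : ∀ i, ∫ ω, (bondChange x (x + Pi.single i 1) t ω : ℝ) ∂jointLaw μ₀ +
      ∫ ω, (bondChange x (x - Pi.single i 1) t ω : ℝ) ∂jointLaw μ₀ ≤ 2 := by
    intro i
    have h2 := integral_bondChange_translate μ₀ hμ₀ (Pi.single i 1) x (x - Pi.single i 1) t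
    rw [sub_add_cancel] at h2
    rw [← h2, ← integral_add (hint _) (integrable_bondChange μ₀ _ _ t)]
    calc ∫ ω, ((bondChange x (x + Pi.single i 1) t ω : ℝ) +
          (bondChange (x + Pi.single i 1) x t ω : ℝ)) ∂jointLaw μ₀
        ≤ ∫ _, (2 : ℝ) ∂jointLaw μ₀ := by
          refine integral_mono_ae ((hint _).add (integrable_bondChange μ₀ _ _ t))
            (integrable_const _) ?_
          filter_upwards [ae_isGood μ₀ hd] with ω hω
          have h3 := bondChange_add_bondChange hω (lattice_adj_add x i).ne t
          have h4 : bondChange x (x + Pi.single i 1) t ω +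
              bondChange (x + Pi.single i 1) x t ω ≤ 2 := by
            rw [h3, spin_mul_eq, spin_mul_eq]
            split_ifs <;> norm_num
          exact_mod_cast h4
      _ = 2 := by simp
  have hf : ∀ i, Integrable (fun ω => (bondChange x (x + Pi.single i 1) t ω : ℝ) +
      (bondChange x (x - Pi.single i 1) t ω : ℝ)) (jointLaw μ₀) := fun i =>
    (hint (x + Pi.single i 1)).add (hint (x - Pi.single i 1))
  calc ∫ ω, (siteChange x t ω : ℝ) ∂jointLaw μ₀
      = ∑ i, (∫ ω, (bondChange x (x + Pi.single i 1) t ω : ℝ) ∂jointLaw μ₀ +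
          ∫ ω, (bondChange x (x - Pi.single i 1) t ω : ℝ) ∂jointLaw μ₀) := by
        simp only [← fun i => integral_add (hint (x + Pi.single i 1)) (hint (x - Pi.single i 1))]
        rw [← integral_finsetSum Finset.univ fun i _ => hf i]
        simp only [siteChange, Int.cast_sum, Int.cast_add]
    _ ≤ ∑ _i : Fin d, (2 : ℝ) := Finset.sum_le_sum fun i _ => h1 i
    _ = 2 * d := by simp [mul_comm]

theorem sum_measure_lowering_le (hd : 1 ≤ d) (hμ₀ : IsTranslationInvariant μ₀) (x : Site d)
    (t : ℝ) (R : ℕ) :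
    ∑ n ∈ Finset.range R, jointLaw μ₀ (lowering x n ∩ {ω | ringTime ω.2 x n ≤ t}) ≤
      ENNReal.ofReal (2 * d) := by
  classical
  have hm : ∀ n, MeasurableSet (lowering x n ∩ {ω | ringTime ω.2 x n ≤ t}) := fun n =>
    (measurableSet_lowering x n).inter (measurableSet_le (measurable_ringTime x n) measurable_const)
  have hint : Integrable (fun ω => (siteChange x t ω : ℝ)) (jointLaw μ₀) := by
    simp only [siteChange, Int.cast_sum, Int.cast_add]
    exact integrable_finsetSum _ fun i _ =>
      (integrable_bondChange μ₀ x _ t).add (integrable_bondChange μ₀ x _ t)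
  have hpt : ∀ᵐ ω ∂jointLaw μ₀, ∑ n ∈ Finset.range R,
      (if ω ∈ lowering x n ∩ {ω | ringTime ω.2 x n ≤ t} then (1 : ℤ) else 0) ≤
        siteChange x t ω := by
    filter_upwards [ae_isGood μ₀ hd] with ω hω
    refine le_trans ?_ (card_lowering_le_siteChange hω x t)
    rw [Finset.sum_boole, Finset.sum_boole]
    refine Nat.cast_le.2 (Finset.card_le_card fun n hn => ?_)
    obtain ⟨-, h1, h2⟩ := Finset.mem_filter.1 hn
    exact Finset.mem_filter.2 ⟨Finset.mem_range.2 (hω.lt_ringsUpTo.2 h2), h1⟩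
  have hnonneg : ∀ᵐ ω ∂jointLaw μ₀, 0 ≤ (siteChange x t ω : ℝ) := by
    filter_upwards [hpt] with ω hω
    have : (0 : ℤ) ≤ siteChange x t ω :=
      (Finset.sum_nonneg fun n _ => by split_ifs <;> norm_num).trans hω
    exact_mod_cast this
  calc ∑ n ∈ Finset.range R, jointLaw μ₀ (lowering x n ∩ {ω | ringTime ω.2 x n ≤ t})
      = ∫⁻ ω, ∑ n ∈ Finset.range R,
          (lowering x n ∩ {ω | ringTime ω.2 x n ≤ t}).indicator 1 ω ∂jointLaw μ₀ := by
        rw [lintegral_finsetSum _ fun n _ => measurable_one.indicator (hm n)]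
        exact Finset.sum_congr rfl fun n _ => (lintegral_indicator_one (hm n)).symm
    _ ≤ ∫⁻ ω, ENNReal.ofReal (siteChange x t ω : ℝ) ∂jointLaw μ₀ := by
        refine lintegral_mono_ae ?_
        filter_upwards [hpt] with ω hω
        have h1 : ((∑ n ∈ Finset.range R, (if ω ∈ lowering x n ∩ {ω | ringTime ω.2 x n ≤ t}
            then (1 : ℤ) else 0) : ℤ) : ℝ) ≤ siteChange x t ω := by exact_mod_cast hω
        refine le_trans (le_of_eq ?_) (ENNReal.ofReal_le_ofReal h1)
        rw [Finset.sum_boole, Int.cast_natCast, ENNReal.ofReal_natCast, ← Finset.sum_boole]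
        exact Finset.sum_congr rfl fun n _ => Set.indicator_apply _ _ _
    _ = ENNReal.ofReal (∫ ω, (siteChange x t ω : ℝ) ∂jointLaw μ₀) :=
        (ofReal_integral_eq_lintegral_ofReal hint hnonneg).symm
    _ ≤ ENNReal.ofReal (2 * d) :=
        ENNReal.ofReal_le_ofReal (integral_siteChange_le μ₀ hd hμ₀ x t)

/-- The expected number of energy lowering rings at a site is finite. -/
theorem tsum_measure_lowering_ne_top (hd : 1 ≤ d) (hμ₀ : IsTranslationInvariant μ₀) (x : Site d) :
    ∑' n, jointLaw μ₀ (lowering x n) ≠ ∞ := by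
  refine ne_top_of_le_ne_top (ENNReal.ofReal_ne_top (r := 2 * d)) ?_
  refine ENNReal.tsum_le_of_sum_range_le fun R => ?_
  have hlim : ∀ n, Tendsto (fun N : ℕ => jointLaw μ₀
      (lowering x n ∩ {ω | ringTime ω.2 x n ≤ N})) atTop (𝓝 (jointLaw μ₀ (lowering x n))) := by
    intro n
    have hmono : Monotone fun N : ℕ =>
        lowering x n ∩ {ω : Config d × Dynamics d | ringTime ω.2 x n ≤ N} := by
      rintro N N' hN ω ⟨h1, h2⟩
      have h3 : (N : ℝ) ≤ N' := by exact_mod_cast hN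
      exact ⟨h1, le_trans h2 h3⟩
    have h := tendsto_measure_iUnion_atTop (μ := jointLaw μ₀) hmono
    have hU : ⋃ N : ℕ, lowering x n ∩ {ω : Config d × Dynamics d | ringTime ω.2 x n ≤ N} =
        lowering x n := by
      rw [← Set.inter_iUnion]
      refine Set.inter_eq_left.2 fun ω _ => ?_
      obtain ⟨N, hN⟩ := exists_nat_ge (ringTime ω.2 x n)
      exact Set.mem_iUnion.2 ⟨N, hN⟩
    rwa [hU] at h
  exact le_of_tendsto' (tendsto_finsetSum _ fun n _ => hlim n)
    fun N => sum_measure_lowering_le μ₀ hd hμ₀ x N R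

end

/-! ### Forcing the next ring -/

/-- The index of the first ring at `y` after the ring `p`. -/
noncomputable def nextIndex (p : Site d × ℕ) (y : Site d) (ω : Config d × Dynamics d) : ℕ :=
  ringsUpTo ω.2 y (ringTime ω.2 p.1 p.2)

/-- The time from the ring `p` to the next ring at `y`. -/
noncomputable def residual (p : Site d × ℕ) (y : Site d) (ω : Config d × Dynamics d) : ℝ :=
  ringTime ω.2 y (nextIndex p y ω) - ringTime ω.2 p.1 p.2

theorem measurable_nextIndex (p : Site d × ℕ) (y : Site d) : Measurable (nextIndex p y) :=
  measurable_ringsUpTo y (measurable_ringTime p.1 p.2)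

theorem measurable_residual (p : Site d × ℕ) (y : Site d) : Measurable (residual p y) :=
  (measurable_apply_nat (measurable_ringTime y) (measurable_nextIndex p y)).sub
    (measurable_ringTime p.1 p.2)

theorem residual_pos {ω : Config d × Dynamics d} (h : IsRegular ω.2) (p : Site d × ℕ)
    (y : Site d) : 0 < residual p y ω :=
  sub_pos.2 (h.lt_ringTime_ringsUpTo y _)

theorem nextIndex_le_iff {ω : Config d × Dynamics d} (h : IsRegular ω.2) {p : Site d × ℕ}
    {y : Site d} {n : ℕ} : nextIndex p y ω ≤ n ↔ ringTime ω.2 p.1 p.2 < ringTime ω.2 y n := by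
  rw [← not_lt, nextIndex, h.lt_ringsUpTo, not_le]

theorem residual_add_le {ω : Config d × Dynamics d} (h : IsRegular ω.2) {p : Site d × ℕ}
    {y : Site d} {n : ℕ} (hn : ringTime ω.2 p.1 p.2 < ringTime ω.2 y n) :
    ringTime ω.2 p.1 p.2 + residual p y ω ≤ ringTime ω.2 y n := by
  rw [residual, add_sub_cancel]
  exact (h.ringTime_strictMono y).monotone ((nextIndex_le_iff h).2 hn)

theorem residual_le_wait {ω : Config d × Dynamics d} (h : IsRegular ω.2) (p : Site d × ℕ)
    (y : Site d) : residual p y ω ≤ (ω.2 (y, nextIndex p y ω)).1 := by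
  unfold residual
  rcases hk : nextIndex p y ω with _ | k
  · rw [ringTime_zero]
    linarith [h.ringTime_pos p.1 p.2]
  · have : ringTime ω.2 y k ≤ ringTime ω.2 p.1 p.2 := by
      by_contra! hc
      have := (nextIndex_le_iff h).2 hc
      omega
    rw [ringTime_succ]
    linarith

/-- Replacing the next waiting time at `y` after the ring `p` changes nothing up to that ring. -/
theorem replaceRing_next {ω : Config d × Dynamics d} (h : IsRegular ω.2) {p : Site d × ℕ}
    {y : Site d} {v : ℝ × Bool} (hv : (ω.2 (y, nextIndex p y ω)).1 < residual p y ω + v.1) :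
    IsRegular (replaceRing (y, nextIndex p y ω) v ω).2 ∧
      AgreeUpTo (ringTime ω.2 p.1 p.2) ω.2 (replaceRing (y, nextIndex p y ω) v ω).2 := by
  set k := nextIndex p y ω with hk
  -- The hypothesis `hv` says that the new residual time stays positive, so the modified ring still
  -- comes after `p`. As the old residual is at most the old waiting time, the new waiting time is
  -- positive too.
  have hv0 : 0 < v.1 := by linarith [residual_le_wait h p y]
  have hrt := fun x n => ringTime_replaceRing (y, k) v ω x n
  refine ⟨⟨fun q => ?_, fun x t => ?_⟩, fun x n hn => ?_⟩
  · rcases eq_or_ne q (y, k) with rfl | hq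
    · rw [replaceRing_apply_self]
      exact hv0
    · simpa [replaceRing, Function.update_of_ne hq] using h.pos q
  · obtain ⟨n, hn⟩ := h.unbounded x (t + |v.1 - (ω.2 (y, k)).1|)
    refine ⟨n, ?_⟩
    rw [hrt]
    split_ifs
    · linarith [neg_abs_le (v.1 - (ω.2 (y, k)).1)]
    · linarith [abs_nonneg (v.1 - (ω.2 (y, k)).1)]
  · have hno : ¬ (y = x ∧ k ≤ n) := by
      rintro ⟨rfl, hkn⟩
      have h1 := (nextIndex_le_iff h).1 hkn
      have h2 := residual_add_le h h1
      rw [hrt, if_pos ⟨rfl, hkn⟩] at hn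
      rcases hn with hn | hn
      · linarith
      · linarith
    refine ⟨by rw [hrt, if_neg hno, add_zero], ?_⟩
    have hne : (x, n) ≠ (y, k) := fun hc => hno (by simp_all)
    simp [replaceRing, Function.update_of_ne hne]

section replace

variable {ω : Config d × Dynamics d} (h : IsRegular ω.2) {p : Site d × ℕ} {y : Site d}
  {v : ℝ × Bool} (hv : (ω.2 (y, nextIndex p y ω)).1 < residual p y ω + v.1)
include h hv

theorem ringTime_replaceRing_next :
    ringTime (replaceRing (y, nextIndex p y ω) v ω).2 p.1 p.2 = ringTime ω.2 p.1 p.2 :=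
  ((replaceRing_next h hv).2 p.1 p.2 (Or.inl le_rfl)).1.symm

theorem nextIndex_replaceRing_next (z : Site d) :
    nextIndex p z (replaceRing (y, nextIndex p y ω) v ω) = nextIndex p z ω := by
  obtain ⟨h1, h2⟩ := replaceRing_next h hv
  rw [nextIndex, ringTime_replaceRing_next h hv, ← h2.ringsUpTo_eq h h1 z, nextIndex]

theorem residual_replaceRing_next_self :
    residual p y (replaceRing (y, nextIndex p y ω) v ω) =
      residual p y ω + v.1 - (ω.2 (y, nextIndex p y ω)).1 := by
  rw [residual, nextIndex_replaceRing_next h hv, ringTime_replaceRing_next h hv,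
    ringTime_replaceRing, if_pos ⟨rfl, le_rfl⟩, residual]
  ring

theorem residual_replaceRing_next_of_ne {z : Site d} (hz : z ≠ y) :
    residual p z (replaceRing (y, nextIndex p y ω) v ω) = residual p z ω := by
  rw [residual, nextIndex_replaceRing_next h hv, ringTime_replaceRing_next h hv,
    ringTime_replaceRing, if_neg (fun hc => hz hc.1.symm), residual, add_zero]

end replace

/-- The event `E` consists of regular realizations and does not depend on the waiting time and
coin of the first ring at `y` after the ring `p`. -/
structure InsensitiveAt (p : Site d × ℕ) (y : Site d) (E : Set (Config d × Dynamics d)) :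
    Prop where
  regular : ∀ ω ∈ E, IsRegular ω.2
  replace : ∀ ω ∈ E, ∀ v : ℝ × Bool, (ω.2 (y, nextIndex p y ω)).1 < residual p y ω + v.1 →
    replaceRing (y, nextIndex p y ω) v ω ∈ E

theorem tsum_measure_inter_fiber {α ι : Type*} [MeasurableSpace α] (P : Measure α) [Countable ι]
    [MeasurableSpace ι] [MeasurableSingletonClass ι] {N : α → ι} (hN : Measurable N) {E : Set α}
    (hE : MeasurableSet E) : ∑' k, P (E ∩ N ⁻¹' {k}) = P E := by
  rw [← measure_iUnion]
  · congr 1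
    ext a
    simp
  · intro k l hkl
    refine Set.disjoint_left.2 fun a h1 h2 => hkl ?_
    exact (h1.2 : N a = k).symm.trans h2.2
  · exact fun k => hE.inter (hN (measurableSet_singleton k))

section

variable (μ₀ : Measure (Config d))

/-- The index of the next ring is random, whereas the shift bound concerns a fixed coordinate.
Decomposing by the value of the index, which the delay must preserve, makes the fibrewise bounds add
up. -/
theorem measure_le_of_delay {p : Site d × ℕ} {y : Site d} {c : ℝ}
    {E F : Set (Config d × Dynamics d)} (hE : MeasurableSet E) (hF : MeasurableSet F)
    (hEF : ∀ ω ∈ E, 0 < (ω.2 (y, nextIndex p y ω)).1 + c ∧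
      delayRing (y, nextIndex p y ω) c ω ∈ F ∧
      nextIndex p y (delayRing (y, nextIndex p y ω) c ω) = nextIndex p y ω) :
    jointLaw μ₀ E ≤ ENNReal.ofReal (Real.exp c) * jointLaw μ₀ F := by
  rw [← tsum_measure_inter_fiber _ (measurable_nextIndex p y) hE,
    ← tsum_measure_inter_fiber _ (measurable_nextIndex p y) hF, ← ENNReal.tsum_mul_left]
  refine ENNReal.tsum_le_tsum fun k => ?_
  refine (measure_mono ?_).trans (jointLaw_delay_le μ₀ (y, k) c
    (hF.inter (measurable_nextIndex p y (measurableSet_singleton k))))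
  rintro ω ⟨hω, rfl⟩
  obtain ⟨h1, h2, h3⟩ := hEF ω hω
  exact ⟨h1, h2, h3⟩

/-- A delay by one unit pushes the residual time above `1` at the price of a factor `e`. -/
theorem measure_le_delay {p : Site d × ℕ} {y : Site d} {E : Set (Config d × Dynamics d)}
    (hE : MeasurableSet E) (hins : InsensitiveAt p y E) :
    jointLaw μ₀ E ≤
      ENNReal.ofReal (Real.exp 1) * jointLaw μ₀ (E ∩ {ω | 1 < residual p y ω}) := by
  refine measure_le_of_delay (p := p) (y := y) μ₀ hE
    (hE.inter (measurableSet_lt measurable_const (measurable_residual p y))) fun ω hω => ?_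
  have hreg := hins.regular ω hω
  have hpos := residual_pos hreg p y
  have hv : (ω.2 (y, nextIndex p y ω)).1 <
      residual p y ω + ((ω.2 (y, nextIndex p y ω)).1 + 1) := by linarith
  refine ⟨by linarith [hreg.pos (y, nextIndex p y ω)], ⟨hins.replace ω hω _ hv, ?_⟩,
    nextIndex_replaceRing_next hreg hv y⟩
  change 1 < residual p y _
  rw [delayRing, residual_replaceRing_next_self hreg hv]
  simp only
  linarith

/-- Turning the coin around preserves the law and maps the `false` half of `E` into the `true` half.
-/
theorem measure_le_coin {p : Site d × ℕ} {y : Site d} {E : Set (Config d × Dynamics d)}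
    (hE : MeasurableSet E) (hins : InsensitiveAt p y E) :
    jointLaw μ₀ E ≤ 2 * jointLaw μ₀ (E ∩ {ω | (ω.2 (y, nextIndex p y ω)).2 = true}) := by
  have hcm : Measurable fun ω : Config d × Dynamics d => (ω.2 (y, nextIndex p y ω)).2 :=
    measurable_apply_nat (f := fun k ω => (ω.2 (y, k)).2) (fun k => by fun_prop)
      (measurable_nextIndex p y)
  set C := {ω : Config d × Dynamics d | (ω.2 (y, nextIndex p y ω)).2 = true} with hC
  have hCm : MeasurableSet C := hcm (measurableSet_singleton true)
  have hN := measurable_nextIndex p y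
  have hle : jointLaw μ₀ (E \ C) ≤ jointLaw μ₀ (E ∩ C) := by
    rw [← tsum_measure_inter_fiber _ hN (hE.diff hCm),
      ← tsum_measure_inter_fiber _ hN (hE.inter hCm)]
    refine ENNReal.tsum_le_tsum fun k => ?_
    rw [← jointLaw_flipCoin μ₀ (y, k) ((hE.inter hCm).inter (hN (measurableSet_singleton k)))]
    refine measure_mono ?_
    rintro ω ⟨⟨hω, hωC⟩, rfl⟩
    have hreg := hins.regular ω hω
    have hv : (ω.2 (y, nextIndex p y ω)).1 < residual p y ω + (ω.2 (y, nextIndex p y ω)).1 := by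
      linarith [residual_pos hreg p y]
    have hidx := nextIndex_replaceRing_next (v := ((ω.2 (y, nextIndex p y ω)).1,
      !(ω.2 (y, nextIndex p y ω)).2)) hreg hv y
    refine ⟨⟨hins.replace ω hω _ hv, ?_⟩, hidx⟩
    change ((flipCoin _ ω).2 (y, nextIndex p y (flipCoin _ ω))).2 = true
    rw [flipCoin, hidx, replaceRing_apply_self]
    simpa [hC] using hωC
  rw [← measure_inter_add_sdiff E hCm, two_mul]
  gcongr

/-- The constant in `measure_le_shorten`. -/
noncomputable def shortenConst : ℝ≥0∞ := ∑' j : ℕ, ENNReal.ofReal (Real.exp (1 - j))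

theorem shortenConst_ne_top : shortenConst ≠ ∞ := by
  have h : Summable fun j : ℕ => Real.exp (1 - j) := by
    have := (Real.summable_exp_neg_nat).mul_left (Real.exp 1)
    refine this.congr fun j => ?_
    rw [← Real.exp_add, sub_eq_add_neg]
  exact h.tsum_ofReal_ne_top

/-- A residual time in `(j - 1, j]` is moved into `(0, 1]` by a delay of `1 - j`; the costs
`e^{1-j}` are summable, so no bound on the residual time is needed. -/
theorem measure_le_shorten {p : Site d × ℕ} {y : Site d} {E : Set (Config d × Dynamics d)}
    (hE : MeasurableSet E) (hins : InsensitiveAt p y E) :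
    jointLaw μ₀ (E ∩ {ω | (ω.2 (y, nextIndex p y ω)).2 = true}) ≤
      shortenConst * jointLaw μ₀ (E ∩ {ω | (ω.2 (y, nextIndex p y ω)).2 = true} ∩
        {ω | residual p y ω ≤ 1}) := by
  have hcm : Measurable fun ω : Config d × Dynamics d => (ω.2 (y, nextIndex p y ω)).2 :=
    measurable_apply_nat (f := fun k ω => (ω.2 (y, k)).2) (fun k => by fun_prop)
      (measurable_nextIndex p y)
  set C := {ω : Config d × Dynamics d | (ω.2 (y, nextIndex p y ω)).2 = true} with hC
  have hCm : MeasurableSet C := hcm (measurableSet_singleton true)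
  have hR : Measurable fun ω => ⌈residual p y ω⌉₊ :=
    Nat.measurable_ceil.comp (measurable_residual p y)
  rw [← tsum_measure_inter_fiber _ hR (hE.inter hCm), shortenConst, ← ENNReal.tsum_mul_right]
  refine ENNReal.tsum_le_tsum fun j => ?_
  refine measure_le_of_delay (p := p) (y := y) μ₀
    ((hE.inter hCm).inter (hR (measurableSet_singleton j)))
    ((hE.inter hCm).inter (measurableSet_le (measurable_residual p y) measurable_const)) ?_
  rintro ω ⟨⟨hω, hωC⟩, hj⟩
  have hreg := hins.regular ω hω
  have hpos := residual_pos hreg p y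
  have hj' : ⌈residual p y ω⌉₊ = j := hj
  have hj1 : residual p y ω ≤ j := hj' ▸ Nat.le_ceil _
  have hj2 : (j : ℝ) < residual p y ω + 1 := hj' ▸ Nat.ceil_lt_add_one hpos.le
  have hv : (ω.2 (y, nextIndex p y ω)).1 <
      residual p y ω + ((ω.2 (y, nextIndex p y ω)).1 + (1 - j)) := by linarith
  have hidx := nextIndex_replaceRing_next (v := ((ω.2 (y, nextIndex p y ω)).1 + (1 - j),
    (ω.2 (y, nextIndex p y ω)).2)) hreg hv y
  refine ⟨by linarith [residual_le_wait hreg p y], ⟨⟨hins.replace ω hω _ hv, ?_⟩, ?_⟩, hidx⟩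
  · change ((delayRing _ _ ω).2 (y, nextIndex p y (delayRing _ _ ω))).2 = true
    rw [delayRing, hidx, replaceRing_apply_self]
    exact hωC
  · change residual p y _ ≤ 1
    rw [delayRing, residual_replaceRing_next_self hreg hv]
    simp only
    linarith

/-- The first ring in `B` after the ring `p` is at `x`, and its coin shows `true`. -/
def nextRingAt (p : Site d × ℕ) (x : Site d) (B : Finset (Site d)) :
    Set (Config d × Dynamics d) :=
  {ω | (ω.2 (x, nextIndex p x ω)).2 = true ∧ residual p x ω ≤ 1 ∧
    ∀ y ∈ B, y ≠ x → 1 < residual p y ω}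

theorem measurableSet_nextRingAt (p : Site d × ℕ) (x : Site d) (B : Finset (Site d)) :
    MeasurableSet (nextRingAt p x B) := by
  have hcm : Measurable fun ω : Config d × Dynamics d => (ω.2 (x, nextIndex p x ω)).2 :=
    measurable_apply_nat (f := fun k ω => (ω.2 (x, k)).2) (fun k => by fun_prop)
      (measurable_nextIndex p x)
  have h : nextRingAt p x B = {ω | (ω.2 (x, nextIndex p x ω)).2 = true} ∩
      ({ω | residual p x ω ≤ 1} ∩ ⋂ y ∈ B, {ω | y ≠ x → 1 < residual p y ω}) := by
    ext ω
    simp [nextRingAt]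
  rw [h]
  refine (hcm (measurableSet_singleton true)).inter
    ((measurableSet_le (measurable_residual p x) measurable_const).inter
      (Finset.measurableSet_biInter _ fun y _ => ?_))
  exact (MeasurableSet.const _).imp (measurableSet_lt measurable_const (measurable_residual p y))

/-- Changing the clock at `y` leaves residual times elsewhere alone, so the forcing can be carried
out site by site. -/
theorem insensitiveAt_inter {p : Site d × ℕ} {y : Site d} {E : Set (Config d × Dynamics d)}
    (hins : InsensitiveAt p y E) {S : Finset (Site d)} (hy : y ∉ S) :
    InsensitiveAt p y (E ∩ {ω | ∀ z ∈ S, 1 < residual p z ω}) where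
  regular ω hω := hins.regular ω hω.1
  replace ω hω v hv := ⟨hins.replace ω hω.1 v hv, fun z hz => by
    rw [residual_replaceRing_next_of_ne (hins.regular ω hω.1) hv (ne_of_mem_of_not_mem hz hy)]
    exact hω.2 z hz⟩

theorem measure_le_delay_finset {p : Site d × ℕ} {E : Set (Config d × Dynamics d)}
    (hE : MeasurableSet E) (hins : ∀ y, InsensitiveAt p y E) (S : Finset (Site d)) :
    jointLaw μ₀ E ≤ ENNReal.ofReal (Real.exp 1) ^ S.card *
      jointLaw μ₀ (E ∩ {ω | ∀ z ∈ S, 1 < residual p z ω}) := by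
  classical
  have hm : ∀ S : Finset (Site d), MeasurableSet {ω | ∀ z ∈ S, 1 < residual p z ω} := by
    intro S
    have : {ω | ∀ z ∈ S, 1 < residual p z ω} = ⋂ z ∈ S, {ω | 1 < residual p z ω} := by ext; simp
    rw [this]
    exact Finset.measurableSet_biInter _ fun z _ =>
      measurableSet_lt measurable_const (measurable_residual p z)
  induction S using Finset.induction_on with
  | empty => simp
  | insert y S hy ih =>
    refine ih.trans ?_
    rw [Finset.card_insert_of_notMem hy, pow_succ, mul_assoc]
    gcongr
    refine (measure_le_delay μ₀ (hE.inter (hm S)) (insensitiveAt_inter (hins y) hy)).trans ?_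
    refine mul_le_mul_right (measure_mono ?_) _
    rintro ω ⟨⟨h1, h2⟩, h3⟩
    refine ⟨h1, fun z hz => ?_⟩
    rcases Finset.mem_insert.1 hz with rfl | hz
    · exact h3
    · exact h2 z hz

/-- Whatever happened up to the ring `p`, with a probability bounded from below the next ring
in `B` is at `x` and its coin shows `true`. -/
theorem measure_le_nextRingAt {p : Site d × ℕ} {E : Set (Config d × Dynamics d)}
    (hE : MeasurableSet E) (hins : ∀ y, InsensitiveAt p y E) (x : Site d) (B : Finset (Site d)) :
    jointLaw μ₀ E ≤ ENNReal.ofReal (Real.exp 1) ^ B.card * (2 * shortenConst) *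
      jointLaw μ₀ (E ∩ nextRingAt p x B) := by
  classical
  have hm : MeasurableSet {ω | ∀ z ∈ B.erase x, 1 < residual p z ω} := by
    have : {ω | ∀ z ∈ B.erase x, 1 < residual p z ω} =
        ⋂ z ∈ B.erase x, {ω | 1 < residual p z ω} := by ext; simp
    rw [this]
    exact Finset.measurableSet_biInter _ fun z _ =>
      measurableSet_lt measurable_const (measurable_residual p z)
  have hins' := insensitiveAt_inter (hins x) (Finset.notMem_erase x B)
  have h1 : (1 : ℝ≥0∞) ≤ ENNReal.ofReal (Real.exp 1) := by
    rw [← ENNReal.ofReal_one]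
    exact ENNReal.ofReal_le_ofReal (Real.one_le_exp zero_le_one)
  -- The other sites are delayed first: the resulting event is still insensitive at `x`, where coin
  -- and waiting time are treated next. Enlarging the exponent to `B.card` makes the constant
  -- independent of `x`.
  refine (measure_le_delay_finset μ₀ hE hins (B.erase x)).trans ?_
  rw [mul_assoc]
  refine mul_le_mul' (pow_le_pow_right₀ h1 (Finset.card_le_card (Finset.erase_subset x B))) ?_
  refine (measure_le_coin μ₀ (hE.inter hm) hins').trans ?_
  rw [mul_assoc]
  gcongr
  refine (measure_le_shorten μ₀ (hE.inter hm) hins').trans ?_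
  refine mul_le_mul_right (measure_mono ?_) _
  rintro ω ⟨⟨⟨h1, h2⟩, h3⟩, h4⟩
  exact ⟨h1, h3, h4, fun y hy hyx => h2 y (Finset.mem_erase.2 ⟨hyx, hy⟩)⟩

end

/-! ### Small clusters -/

/-- The configuration right after the ring `p`. -/
noncomputable def stateAfterRing (p : Site d × ℕ) (ω : Config d × Dynamics d) : Config d :=
  stateAt ω.2 ω.1 (ringTime ω.2 p.1 p.2)

theorem measurable_stateAfterRing (p : Site d × ℕ) : Measurable (stateAfterRing p) :=
  measurable_stateAt (measurable_ringTime p.1 p.2)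

/-- Right after the ring `p` the cluster of `z` has at most `M` sites. -/
def smallCluster (z : Site d) (M : ℕ) (p : Site d × ℕ) : Set (Config d × Dynamics d) :=
  {ω | (cluster (stateAfterRing p ω) z).encard ≤ M}

theorem measurableSet_smallCluster (z : Site d) (M : ℕ) (p : Site d × ℕ) :
    MeasurableSet (smallCluster z M p) :=
  measurable_stateAfterRing p (measurableSet_encard_cluster_le z M)

/-- Right after the ring `p` the cluster of `z` has at most `M` sites, and it contains `x`, where a
flip would not raise the energy. -/
def flippable (z : Site d) (M : ℕ) (p : Site d × ℕ) (x : Site d) :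
    Set (Config d × Dynamics d) :=
  {ω | IsRegular ω.2} ∩ (smallCluster z M p ∩ {ω | x ∈ cluster (stateAfterRing p ω) z} ∩
    {ω | energyChange (stateAfterRing p ω) x ≤ 0})

theorem measurableSet_isRegular :
    MeasurableSet {ω : Config d × Dynamics d | IsRegular ω.2} := by
  have h : {ω : Config d × Dynamics d | IsRegular ω.2} =
      (⋂ q, {ω | 0 < (ω.2 q).1}) ∩ ⋂ x, ⋂ N : ℕ, ⋃ n, {ω | (N : ℝ) < ringTime ω.2 x n} := by
    ext ω
    simp only [Set.mem_inter_iff, Set.mem_iInter, Set.mem_iUnion, Set.mem_ofPred_eq]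
    constructor
    · exact fun h => ⟨h.pos, fun x N => h.unbounded x N⟩
    · rintro ⟨h1, h2⟩
      refine ⟨h1, fun x t => ?_⟩
      obtain ⟨N, hN⟩ := exists_nat_gt t
      obtain ⟨n, hn⟩ := h2 x N
      exact ⟨n, hN.trans hn⟩
  rw [h]
  refine (MeasurableSet.iInter fun q => measurableSet_lt measurable_const (by fun_prop)).inter ?_
  exact .iInter fun x => .iInter fun N => .iUnion fun n =>
    measurableSet_lt measurable_const (measurable_ringTime x n)

theorem measurableSet_flippable (z : Site d) (M : ℕ) (p : Site d × ℕ) (x : Site d) :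
    MeasurableSet (flippable z M p x) :=
  measurableSet_isRegular.inter (((measurableSet_smallCluster z M p).inter
    (measurable_stateAfterRing p (measurableSet_mem_cluster z x))).inter
    ((measurable_energyChange x).comp (measurable_stateAfterRing p)
      (measurableSet_Iic (a := (0 : ℤ)))))

/-- The event is read off from the state right after `p`, which is determined by the rings and coins
up to that time. -/
theorem insensitiveAt_flippable (z : Site d) (M : ℕ) (p : Site d × ℕ) (x y : Site d) :
    InsensitiveAt p y (flippable z M p x) where
  regular ω hω := hω.1
  replace ω hω v hv := by
    obtain ⟨hreg, hag⟩ := replaceRing_next hω.1 hv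
    have h : stateAfterRing p (replaceRing (y, nextIndex p y ω) v ω) = stateAfterRing p ω := by
      rw [stateAfterRing, stateAfterRing, ringTime_replaceRing_next hω.1 hv,
        hag.stateAt_eq hω.1 hreg ω.1]
      rfl
    refine ⟨hreg, ?_⟩
    have h2 := hω.2
    simp only [smallCluster, Set.mem_inter_iff, Set.mem_ofPred_eq] at h2 ⊢
    rwa [h]

/-- If the next ring flips a site of a small cluster, then the energy is lowered or some cluster
becomes smaller. -/
theorem lowering_or_smallCluster (hd : 1 ≤ d) {ω : Config d × Dynamics d} (h : IsGood ω.2)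
    {z x : Site d} {M : ℕ} {B : Finset (Site d)} (hB : box z (M + 1) ⊆ B) {p : Site d × ℕ}
    (hω : ω ∈ flippable z (M + 1) p x) (hnext : ω ∈ nextRingAt p x B) :
    ω ∈ lowering x (nextIndex p x ω) ∨ ∃ w ∈ B, ω ∈ smallCluster w M (x, nextIndex p x ω) := by
  obtain ⟨hcoin, hres, hothers⟩ := hnext
  obtain ⟨-, ⟨hsmall, hx⟩, henergy⟩ := hω
  set k := nextIndex p x ω with hk
  set σ := stateAfterRing p ω with hσ
  have hsmall' : (cluster σ z).encard ≤ (M + 1 : ℕ) := hsmall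
  have hx' : x ∈ cluster σ z := hx
  have hT : ringTime ω.2 x k = ringTime ω.2 p.1 p.2 + residual p x ω := by
    rw [residual]
    ring
  have hpos := residual_pos h.toIsRegular p x
  -- No other clock in `B` rings between `p` and the next ring at `x`: the latter comes within time
  -- `1`, the others later. Hence the state on `B` just before the ring at `x` is still `σ`.
  have hcount : ∀ y ∈ B, y ≠ x → ∀ n,
      ringTime ω.2 y n ≤ ringTime ω.2 p.1 p.2 ∨ ringTime ω.2 x k < ringTime ω.2 y n := by
    intro y hy hyx n
    by_contra! hc
    have h1 := residual_add_le h.toIsRegular hc.1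
    have h2 := hothers y hy hyx
    linarith [hc.2]
  have hbefore : ∀ y ∈ B, stateBefore ω.2 ω.1 (ringTime ω.2 x k) y = σ y := by
    intro y hy
    simp only [stateBefore, hσ, stateAfterRing, stateAt]
    congr 1
    rcases eq_or_ne y x with rfl | hyx
    · rw [h.ringsBefore_ringTime]
      rfl
    · refine (h.ringsUpTo_eq_ringsBefore fun n => ⟨fun hn => by linarith, fun hn => ?_⟩).symm
      exact (hcount y hy hyx n).resolve_right (not_lt.2 hn.le)
  have hafter : ∀ y ∈ B, y ≠ x → σ y = stateAfterRing (x, k) ω y := by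
    intro y hy hyx
    simp only [hσ, stateAfterRing, stateAt]
    congr 1
    refine h.ringsUpTo_eq_ringsUpTo fun n => ⟨fun hn => by linarith, fun hn => ?_⟩
    exact (hcount y hy hyx n).resolve_right (not_lt.2 hn)
  have hstar : star x ⊆ B := (star_subset_box hsmall' hx').trans hB
  have hxB : x ∈ B := hstar (mem_star.2 (Or.inl rfl))
  have hE : energyChange (stateBefore ω.2 ω.1 (ringTime ω.2 x k)) x = energyChange σ x :=
    energyChange_congr (hbefore x hxB) fun y hy => hbefore y (hstar (mem_star.2 (Or.inr hy)))
  rcases (show energyChange σ x ≤ 0 from henergy).lt_or_eq with hlt | h0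
  · left
    change energyChange (stateBefore ω.2 ω.1 (ringTime ω.2 x k)) x < 0
    rwa [hE]
  · right
    -- At a tie some neighbour shares the spin of `x`; it is the survivor whose cluster is contained
    -- in the old one without `x`.
    obtain ⟨w, hxw, hspin⟩ := exists_adj_eq_of_energyChange_eq_zero hd h0
    refine ⟨w, hstar (mem_star.2 (Or.inr hxw)), ?_⟩
    refine encard_cluster_le_of_flip hsmall' hx' (mem_cluster_of_adj hx' hxw hspin) hxw.ne'
      ?_ (fun b hb hbx => hafter b (hB hb) hbx)
    simp only [stateAfterRing, stateAt, h.ringsUpTo_ringTime]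
    rw [spinAfter_succ h.toIsRegular h.wellFounded, updatedSpin, hE, h0, hbefore x hxB,
      if_pos (Or.inr ⟨rfl, hcoin⟩)]

/-- A ring at `x` in `B` determines the ring in `B` before it. -/
theorem eq_of_nextRingAt {ω : Config d × Dynamics d} (h : IsGood ω.2) {x : Site d}
    {B : Finset (Site d)} {p p' : Site d × ℕ} (hpB : p.1 ∈ B) (hpB' : p'.1 ∈ B)
    (hp : ω ∈ nextRingAt p x B) (hp' : ω ∈ nextRingAt p' x B)
    (heq : nextIndex p x ω = nextIndex p' x ω) : p = p' := by
  -- Were `p` earlier than `p'`, then `p'` would be a ring in `B` after `p` and before the common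
  -- next ring at `x`, which `nextRingAt` for `p` excludes.
  have key : ∀ p p' : Site d × ℕ, p'.1 ∈ B → ω ∈ nextRingAt p x B →
      nextIndex p x ω = nextIndex p' x ω →
      ¬ ringTime ω.2 p.1 p.2 < ringTime ω.2 p'.1 p'.2 := by
    rintro p ⟨y, m⟩ hpB' ⟨-, hres, hothers⟩ heq hlt
    simp only at hlt hpB'
    have h1 := residual_pos h.toIsRegular (y, m) x
    rw [residual, ← heq] at h1
    rw [residual] at hres
    rcases eq_or_ne y x with rfl | hyx
    · have h2 := (nextIndex_le_iff h.toIsRegular).2 hlt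
      have h3 := (h.ringTime_strictMono y).monotone h2
      linarith
    · have h2 := residual_add_le h.toIsRegular hlt
      have h3 := hothers y hpB' hyx
      linarith
  have hT : ringTime ω.2 p.1 p.2 = ringTime ω.2 p'.1 p'.2 :=
    le_antisymm (not_lt.1 (key p' p hpB hp' heq.symm)) (not_lt.1 (key p p' hpB' hp heq))
  obtain ⟨y, m⟩ := p
  obtain ⟨y', m'⟩ := p'
  rcases eq_or_ne y y' with rfl | hne
  · exact Prod.ext rfl ((h.ringTime_strictMono y).injective hT)
  · exact absurd hT (h.noTie _ _ hne)

section

variable (μ₀ : Measure (Config d)) [IsProbabilityMeasure μ₀]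

/-- A given ring at `x` can be the next ring of only one `p`, so the events are almost surely
disjoint and their probabilities sum to that of one union. This is what prevents the outcomes from
being overcounted. -/
theorem tsum_measure_next_le (hd : 1 ≤ d) {z x : Site d} {M : ℕ} {B : Finset (Site d)}
    (hB : box z (M + 1) ⊆ B) (k : ℕ) :
    ∑' p : B × ℕ, jointLaw μ₀ (flippable z (M + 1) (p.1, p.2) x ∩ nextRingAt (p.1, p.2) x B ∩
      nextIndex (p.1.1, p.2) x ⁻¹' {k}) ≤
    jointLaw μ₀ (lowering x k) + ∑ w ∈ B, jointLaw μ₀ (smallCluster w M (x, k)) := by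
  have hgood : jointLaw μ₀ {ω | IsGood ω.2}ᶜ = 0 := ae_isGood μ₀ hd
  rw [← measure_iUnion₀]
  · refine (measure_mono_ae (t := lowering x k ∪ ⋃ w ∈ B, smallCluster w M (x, k)) ?_).trans
      ((measure_union_le _ _).trans (add_le_add_right (measure_biUnion_finset_le _ _) _))
    filter_upwards [ae_isGood μ₀ hd] with ω hω hmem
    obtain ⟨p, ⟨h1, h2⟩, h3⟩ := Set.mem_iUnion.1 hmem
    obtain rfl : nextIndex (p.1.1, p.2) x ω = k := h3
    rcases lowering_or_smallCluster hd hω hB h1 h2 with h | ⟨w, hw, h⟩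
    · exact Or.inl h
    · exact Or.inr (Set.mem_biUnion hw h)
  · intro p p' hpp'
    refine measure_mono_null (t := {ω | IsGood ω.2}ᶜ) ?_ hgood
    intro ω hω hω'
    refine hpp' ?_
    obtain ⟨⟨⟨-, h1⟩, h2⟩, ⟨⟨-, h3⟩, h4⟩⟩ := hω
    have h5 : nextIndex (p.1.1, p.2) x ω = k := h2
    have h6 : nextIndex (p'.1.1, p'.2) x ω = k := h4
    have h7 := eq_of_nextRingAt hω' p.1.2 p'.1.2 h1 h3 (h5.trans h6.symm)
    obtain ⟨h8, h9⟩ := Prod.mk.inj h7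
    exact Prod.ext (Subtype.ext h8) h9
  · exact fun p => (((measurableSet_flippable _ _ _ _).inter (measurableSet_nextRingAt _ _ _)).inter
      (measurable_nextIndex _ _ (measurableSet_singleton k))).nullMeasurableSet

/-- The expected number of rings in `B` after which the cluster of `z` is small is finite. -/
theorem tsum_measure_smallCluster_ne_top (hd : 1 ≤ d) (hμ₀ : IsTranslationInvariant μ₀) (M : ℕ) :
    ∀ (B : Finset (Site d)) (z : Site d),
      ∑' p : B × ℕ, jointLaw μ₀ (smallCluster z M (p.1, p.2)) ≠ ∞ := by
  classical
  induction M with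
  | zero =>
    intro B z
    have : ∀ p : Site d × ℕ, smallCluster z 0 p = ∅ := fun p =>
      Set.eq_empty_of_forall_notMem fun ω hω => by
        have h1 : (cluster (stateAfterRing p ω) z).encard ≤ (0 : ℕ) := hω
        rw [Nat.cast_zero] at h1
        have h2 := Set.encard_eq_zero.1 (le_antisymm h1 zero_le)
        exact Set.notMem_empty z (h2 ▸ self_mem_cluster _ z)
    simp [this]
  | succ M ih =>
    -- Enlarging `B` only adds terms, so `B` may be assumed to contain the box that decides the
    -- cluster. The induction hypothesis is needed for all centres, since the surviving cluster is
    -- that of another site `w`.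
    suffices H : ∀ (B : Finset (Site d)) (z : Site d), box z (M + 1) ⊆ B →
        ∑' p : B × ℕ, jointLaw μ₀ (smallCluster z (M + 1) (p.1, p.2)) ≠ ∞ by
      intro B z
      have hsub : B ⊆ B ∪ box z (M + 1) := Finset.subset_union_left
      refine ne_top_of_le_ne_top (H (B ∪ box z (M + 1)) z Finset.subset_union_right) ?_
      let f : B × ℕ → (B ∪ box z (M + 1) : Finset (Site d)) × ℕ :=
        fun p => (⟨p.1, hsub p.1.2⟩, p.2)
      have hf : Function.Injective f := fun p q hpq =>
        Prod.ext (Subtype.ext (congrArg (fun r => (r.1 : Site d)) hpq))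
          (congrArg (fun r => r.2) hpq)
      exact ENNReal.tsum_comp_le_tsum_of_injective hf
        (fun p => jointLaw μ₀ (smallCluster z (M + 1) (p.1, p.2)))
    intro B z hB
    set K : ℝ≥0∞ := ENNReal.ofReal (Real.exp 1) ^ B.card * (2 * shortenConst) with hK
    have hKtop : K ≠ ∞ := ENNReal.mul_ne_top (ENNReal.pow_ne_top ENNReal.ofReal_ne_top)
      (ENNReal.mul_ne_top (by simp) shortenConst_ne_top)
    have h1 : ∀ p : B × ℕ, jointLaw μ₀ (smallCluster z (M + 1) (p.1, p.2)) ≤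
        ∑' x : B, ∑' k : ℕ, K * jointLaw μ₀ (flippable z (M + 1) (p.1, p.2) x ∩
          nextRingAt (p.1, p.2) x B ∩ nextIndex (p.1.1, p.2) x ⁻¹' {k}) := by
      intro p
      have hcover : smallCluster z (M + 1) (p.1.1, p.2) ≤ᵐ[jointLaw μ₀]
          ⋃ x : B, flippable z (M + 1) (p.1, p.2) x := by
        filter_upwards [ae_isRegular μ₀] with ω hω hmem
        obtain ⟨x, hx, hE⟩ := exists_energyChange_nonpos (cluster_finite hmem)
        have hxB : x ∈ B := hB (star_subset_box hmem hx (mem_star.2 (Or.inl rfl)))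
        exact Set.mem_iUnion.2 ⟨⟨x, hxB⟩, hω, ⟨hmem, hx⟩, hE⟩
      refine (measure_mono_ae hcover).trans ((measure_iUnion_le _).trans
        (ENNReal.tsum_le_tsum fun x => ?_))
      rw [ENNReal.tsum_mul_left, tsum_measure_inter_fiber _ (measurable_nextIndex _ _)
        ((measurableSet_flippable _ _ _ _).inter (measurableSet_nextRingAt _ _ _))]
      exact measure_le_nextRingAt μ₀ (measurableSet_flippable _ _ _ _)
        (fun y => insensitiveAt_flippable z (M + 1) (p.1, p.2) x y) x B
    have h2 : ∑' p : B × ℕ, jointLaw μ₀ (smallCluster z (M + 1) (p.1, p.2)) ≤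
        ∑' x : B, ∑' k : ℕ, K * (jointLaw μ₀ (lowering (x : Site d) k) +
          ∑ w ∈ B, jointLaw μ₀ (smallCluster w M (x, k))) := by
      refine (ENNReal.tsum_le_tsum h1).trans ?_
      -- The sum over `p` is moved inside, where for each fixed next ring `(x, k)` the disjointness
      -- bound applies.
      rw [ENNReal.tsum_comm]
      refine ENNReal.tsum_le_tsum fun x => ?_
      rw [ENNReal.tsum_comm]
      refine ENNReal.tsum_le_tsum fun k => ?_
      rw [ENNReal.tsum_mul_left]
      gcongr
      exact tsum_measure_next_le μ₀ hd hB k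
    refine ne_top_of_le_ne_top ?_ h2
    simp only [ENNReal.tsum_mul_left, ENNReal.tsum_add]
    refine ENNReal.mul_ne_top hKtop (ENNReal.add_ne_top.2 ⟨?_, ?_⟩)
    · rw [tsum_fintype]
      exact ENNReal.sum_ne_top.2 fun x _ => tsum_measure_lowering_ne_top μ₀ hd hμ₀ x
    · rw [← ENNReal.tsum_prod (f := fun (x : B) (k : ℕ) =>
        ∑ w ∈ B, jointLaw μ₀ (smallCluster w M ((x : Site d), k))),
        Summable.tsum_finsetSum fun _ _ => ENNReal.summable]
      exact ENNReal.sum_ne_top.2 fun w _ => ih B w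

/-- Almost surely the cluster of `z` is eventually larger than any given size. -/
theorem ae_eventually_lt_encard_cluster (hd : 1 ≤ d) (hμ₀ : IsTranslationInvariant μ₀)
    (z : Site d) (M : ℕ) : ∀ᵐ ω ∂jointLaw μ₀, ∀ᶠ t : ℝ≥0 in atTop,
      (M : ℕ∞) < (cluster (stateAt ω.2 ω.1 t) z).encard := by
  set B := insert z (box z M) with hB
  have hbc : ∀ᵐ ω ∂jointLaw μ₀, {p : B × ℕ | ω ∈ smallCluster z M (p.1, p.2)}.Finite :=
    ae_finite_setOfPred_mem (tsum_measure_smallCluster_ne_top μ₀ hd hμ₀ M B z)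
  filter_upwards [hbc, ae_isRegular μ₀] with ω hω h
  obtain ⟨t₀, ht₀⟩ : ∃ t₀, ∀ p ∈ {p : B × ℕ | ω ∈ smallCluster z M (p.1, p.2)},
      ringTime ω.2 p.1 p.2 ≤ t₀ := by
    obtain ⟨t₀, ht₀⟩ := (hω.image fun p : B × ℕ => ringTime ω.2 p.1 p.2).bddAbove
    exact ⟨t₀, fun p hp => ht₀ ⟨p, hp, rfl⟩⟩
  -- A ring at `z` after `t₀` guarantees that, for all later `t`, the last ring in `B` before `t`
  -- also comes after `t₀`. The box has not changed since that ring, so a small cluster at time `t`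
  -- would already be small right after it.
  obtain ⟨n, hn⟩ := h.unbounded z t₀
  filter_upwards [eventually_ge_atTop (⟨ringTime ω.2 z n, (h.ringTime_pos z n).le⟩ : ℝ≥0)]
    with t ht
  have ht' : ringTime ω.2 z n ≤ t := ht
  by_contra! hsmall
  have hzB : z ∈ B := Finset.mem_insert_self _ _
  have hpast : {p : B × ℕ | ringTime ω.2 p.1 p.2 ≤ t}.Finite := by
    have : (⋃ y : B, Prod.mk y '' {n | ringTime ω.2 y n ≤ t}).Finite :=
      Set.finite_iUnion fun y => (h.finite_setOf_ringTime_le y t).image _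
    refine this.subset fun p hp => Set.mem_iUnion.2 ⟨p.1, p.2, hp, rfl⟩
  obtain ⟨q, hq, hmax⟩ := Set.exists_max_image _ (fun p : B × ℕ => ringTime ω.2 p.1 p.2) hpast
    ⟨(⟨z, hzB⟩, n), ht'⟩
  have hq' : ringTime ω.2 q.1 q.2 ≤ t := hq
  have hagree : ∀ b ∈ box z M, stateAt ω.2 ω.1 t b = stateAfterRing (q.1.1, q.2) ω b := by
    intro b hb
    simp only [stateAfterRing, stateAt]
    congr 1
    refine h.ringsUpTo_eq_ringsUpTo fun m => ⟨fun hm => ?_, fun hm => hm.trans hq'⟩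
    exact hmax (⟨b, Finset.mem_insert_of_mem hb⟩, m) hm
  have h1 := ht₀ q (encard_cluster_le_of_eqOn_box hsmall hagree)
  have h2 := hmax (⟨z, hzB⟩, n) ht'
  simp only at h2
  linarith

/-- Almost surely there is exactly one trajectory, and along it the cluster of the origin grows
without bounds. -/
theorem ae_existsUnique_trajectory_tendsto (hd : 1 ≤ d) (hμ₀ : IsTranslationInvariant μ₀) :
    ∀ᵐ ω ∂jointLaw μ₀, ∃ σ : ℝ≥0 → Config d, IsTrajectory ω.1 ω.2 σ ∧
      (∀ σ' : ℝ≥0 → Config d, IsTrajectory ω.1 ω.2 σ' → σ' = σ) ∧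
      Tendsto (fun t : ℝ≥0 => (cluster (σ t) 0).encard) atTop (𝓝 ⊤) := by
  filter_upwards [ae_isGood μ₀ hd, ae_all_iff.2 fun M =>
    ae_eventually_lt_encard_cluster μ₀ hd hμ₀ 0 M] with ω h hM
  exact ⟨fun t => stateAt ω.2 ω.1 t, isTrajectory_stateAt h.toIsRegular h.wellFounded ω.1,
    fun σ' hσ' => hσ'.eq_stateAt h.toIsRegular h.wellFounded,
    ENat.tendsto_nhds_top_iff_natCast_lt.2 hM⟩

end

end ZeroTempIsing
theorem proposition1 (d : ℕ) (hd : 1 ≤ d) :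
    (∀ᵐ ω ∂(jointLaw (symmetricBernoulli d)),
      ∃ σ : ℝ≥0 → Config d, IsTrajectory ω.1 ω.2 σ ∧
        (∀ σ' : ℝ≥0 → Config d, IsTrajectory ω.1 ω.2 σ' → σ' = σ) ∧
        Tendsto (fun t : ℝ≥0 => (cluster (σ t) 0).encard) atTop (𝓝 ⊤)) ∧
    (∀ μ₀ : Measure (Config d), IsProbabilityMeasure μ₀ → IsTranslationInvariant μ₀ →
      ∀ᵐ ω ∂(jointLaw μ₀),
        ∃ σ : ℝ≥0 → Config d, IsTrajectory ω.1 ω.2 σ ∧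
          (∀ σ' : ℝ≥0 → Config d, IsTrajectory ω.1 ω.2 σ' → σ' = σ) ∧
          Tendsto (fun t : ℝ≥0 => (cluster (σ t) 0).encard) atTop (𝓝 ⊤)) := by
  exact ⟨ae_existsUnique_trajectory_tendsto _ hd isTranslationInvariant_symmetricBernoulli,
    fun μ₀ _ hμ₀ => ae_existsUnique_trajectory_tendsto μ₀ hd hμ₀⟩
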